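/- Let $T>0$. For real $s\ge 0$ with $m=\lfloor s\rfloor$, $\sigma=s-m$, let $H^s(0,T)$ be the Sobolev(–Slobodeckij) space with norm $$\|\varphi\|_{H^s(0,T)}^2=\sum_{j=0}^{m}\|\varphi^{(j)}\|_{L^2(0,T)}^2+\int_0^T\!\!\int_0^T\frac{|\varphi^{(m)}(t)-\varphi^{(m)}(r)|^2}{|t-r|^{1+2\sigma}}\,dr\,dt ,$$ the double integral being omitted when $s$ is an integer. For $u\in L^1(0,T)$ and $s>1/2$ put $$\|u\|_{[H^s(0,T)]^*}=\sup\Big\{\Big|\int_0^T u\varphi\,dt\Big| : \varphi\in H^s(0,T),\ \|\varphi\|_{H^s(0,T)}\le 1\Big\}.$$ **Proposition.** There exists a constant $C>0$ depending only on $T$ such that the following holds. Let $u\in L^1(0,T)$ be real-valued and let $y\in C([0,T],L^2(0,1))\cap L^2((0,T),H^1(0,1))$ be the weak solution of $$y_t-y_{xx}=u(t)\ \text{ in }(0,T)\times(0,1),\qquad y(t,0)=y(t,1)=0,\qquad y(0,\cdot)=0,$$ that is, for every $\tau\in[0,T]$ and every $\phi\in C([0,T],H^1_0(0,1))\cap L^2((0,T),H^2(0,1))\cap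 H^1((0,T)\times(0,1))$, $$\int_0^1 y(\tau,x)\phi(\tau,x)\,dx-\int_0^\tau\!\!\int_0^1 y\,(\phi_t+\phi_{xx})\,dx\,dt=\int_0^\tau\!\!\int_0^1 u(t)\phi(t,x)\,dx\,dt .$$ Let $U(t)=\int_0^t u(s)\,ds$. Then - $\|y\|_{L^2((0,T),H^1(0,1))}\le C\,\|u\|_{[H^{3/4}(0,T)]^*}$; - $\|y-U\|_{L^2((0,T)\times(0,1))}\le C\,\|u\|_{[H^{5/4}(0,T)]^*}$; - $\|y\|_{L^2((0,T)\times(0,1))}\le C\,\|u\|_{[H^{1}(0,T)]^*}$. -/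

import Mathlib

open MeasureTheory Set
open scoped ENNReal NNReal ContDiff

noncomputable section

namespace HeatControl

/-- `g` is the weak (distributional) derivative of `f` on the open interval `(a, b)`: both are
locally integrable there and `∫ η' f = - ∫ η g` for every `η ∈ C_c^∞((a, b))`. The functions may
be scalar-valued or take values in a Banach space (Bochner integrals). -/
def HasWeakDeriv {E : Type*} [NormedAddCommGroup E] [NormedSpace ℝ E] [CompleteSpace E]
    (a b : ℝ) (f g : ℝ → E) : Prop :=
  LocallyIntegrableOn f (Ioo a b) ∧ LocallyIntegrableOn g (Ioo a b) ∧
    ∀ η : ℝ → ℝ, ContDiff ℝ ∞ η → HasCompactSupport η → tsupport η ⊆ Ioo a b →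
      ∫ x in Ioo a b, deriv η x • f x = - ∫ x in Ioo a b, η x • g x

/-- The square of the Gagliardo (Sobolev–Slobodeckij) seminorm of order `σ ∈ (0, 1)` on `(a, b)`:
`∫_a^b ∫_a^b |f x - f z|² / |x - z|^(1 + 2 σ) dz dx`. -/
def gagliardoSq (a b σ : ℝ) (f : ℝ → ℝ) : ℝ≥0∞ :=
  ∫⁻ x in Ioo a b, ∫⁻ z in Ioo a b, ‖f x - f z‖ₑ ^ 2 / ‖x - z‖ₑ ^ (1 + 2 * σ)

/-- `D 0, D 1, …, D ⌊s⌋` all lie in `L²(a, b)` and each is the weak derivative of the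
preceding one. -/
structure IsWeakDerivChain (a b s : ℝ) (D : ℕ → ℝ → ℝ) : Prop where
  memLp : ∀ j ≤ ⌊s⌋₊, MemLp (D j) 2 (volume.restrict (Ioo a b))
  weakDeriv : ∀ j < ⌊s⌋₊, HasWeakDeriv a b (D j) (D (j + 1))

/-- The norm of `f` in `H^s(a, b)`, `0 ≤ s`, with values in `[0, ∞]`; it is `∞` exactly when
`f ∉ H^s(a, b)`. With `m = ⌊s⌋` and `σ = s - m` it is the square root of
`∑_{j ≤ m} ‖f^{(j)}‖²_{L²} + [f^{(m)}]²_σ`, the last term being absent when `s` is an integer.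
Weak derivatives are unique almost everywhere, so the expression is the same for all chains `D`
starting at `f`; the infimum over the empty set is `∞`. -/
def sobolevENorm (a b s : ℝ) (f : ℝ → ℝ) : ℝ≥0∞ :=
  ⨅ (D : ℕ → ℝ → ℝ) (_ : IsWeakDerivChain a b s D ∧ D 0 = f),
    ((∑ j ∈ Finset.range (⌊s⌋₊ + 1), eLpNorm (D j) 2 (volume.restrict (Ioo a b)) ^ 2) +
      (if s - ⌊s⌋₊ = 0 then 0 else gagliardoSq a b (s - ⌊s⌋₊) (D ⌊s⌋₊))) ^ (1 / 2 : ℝ)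

/-- The norm of `u ∈ L¹(0, T)` in the dual space `[H^s(0, T)]^*`, `u` being identified with the
functional `φ ↦ ∫_0^T u φ`. For `s > 1/2` the elements of `H^s(0, T)` are essentially bounded, so
that all these integrals converge absolutely. -/
def dualENorm (T s : ℝ) (u : ℝ → ℝ) : ℝ≥0∞ :=
  ⨆ (φ : ℝ → ℝ) (_ : sobolevENorm 0 T s φ ≤ 1), ‖∫ t in Ioo 0 T, u t * φ t‖ₑ

/-- The Hilbert space `L²(0, 1)`. -/
abbrev L2 : Type := Lp ℝ 2 (volume.restrict (Ioo (0 : ℝ) 1))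

/-- The constant function `c` as an element of `L²(0, 1)`. -/
def constL2 (c : ℝ) : L2 := Lp.const 2 (volume.restrict (Ioo (0 : ℝ) 1)) c

/-- The norm of `y` in `L²((0, T), H¹(0, 1))`, with values in `[0, ∞]`. -/
def normL2H1 (T : ℝ) (y : ℝ → L2) : ℝ≥0∞ :=
  (∫⁻ t in Ioo 0 T, sobolevENorm 0 1 1 (y t) ^ 2) ^ (1 / 2 : ℝ)

/-- The norm of `y` in `L²((0, T) × (0, 1)) = L²((0, T), L²(0, 1))`, with values in `[0, ∞]`. -/
def normL2L2 (T : ℝ) (y : ℝ → L2) : ℝ≥0∞ :=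
  eLpNorm y 2 (volume.restrict (Ioo 0 T))

/-- `y ∈ Y_T = C([0, T], L²(0, 1)) ∩ L²((0, T), H¹(0, 1))`. (Strong measurability of `y` as an
`H¹(0, 1)`-valued map follows from continuity into `L²(0, 1)`.) -/
structure MemYT (T : ℝ) (y : ℝ → L2) : Prop where
  continuousOn : ContinuousOn y (Icc 0 T)
  normL2H1_lt_top : normL2H1 T y < ⊤

/-- `w ∈ H¹_0(0, 1)` with weak derivative `w'`: the continuous representative of `w` on `[0, 1]`
vanishes at both end points. -/
def MemH10 (w w' : L2) : Prop :=
  HasWeakDeriv 0 1 (w : ℝ → ℝ) (w' : ℝ → ℝ) ∧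
    ∃ f : ℝ → ℝ, ContinuousOn f (Icc 0 1) ∧ f 0 = 0 ∧ f 1 = 0 ∧
      (w : ℝ → ℝ) =ᵐ[volume.restrict (Ioo (0 : ℝ) 1)] f

/-- `φ ∈ C([0, T], H¹_0(0, 1)) ∩ L²((0, T), H²(0, 1)) ∩ H¹((0, T) × (0, 1))`, with weak
derivatives `φ_t = φt`, `φ_x = φx`, `φ_xx = φxx`. -/
structure IsTestFunction (T : ℝ) (φ φt φx φxx : ℝ → L2) : Prop where
  continuousOn : ContinuousOn φ (Icc 0 T)
  continuousOn_x : ContinuousOn φx (Icc 0 T)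
  memH10 : ∀ t ∈ Icc 0 T, MemH10 (φ t) (φx t)
  memLp_xx : MemLp φxx 2 (volume.restrict (Ioo 0 T))
  weakDeriv_xx : ∀ᵐ t ∂volume.restrict (Ioo 0 T),
    HasWeakDeriv 0 1 (φx t : ℝ → ℝ) (φxx t : ℝ → ℝ)
  memLp_t : MemLp φt 2 (volume.restrict (Ioo 0 T))
  weakDeriv_t : HasWeakDeriv 0 T φ φt

/-- `y ∈ Y_T` is a weak solution of `y_t - y_xx = f` in `(0, T) × (0, 1)` with
`y(t, 0) = y(t, 1) = 0` and `y(0, ·) = y₀`: for every `τ ∈ [0, T]` and every test function `φ`,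
`∫_0^1 y(τ) φ(τ) - ∫_0^1 y₀ φ(0) - ∫_0^τ ∫_0^1 y (φ_t + φ_xx) = ∫_0^τ ∫_0^1 f φ`.
The integrals over `(0, 1)` are inner products of `L²(0, 1)`. -/
structure IsHeatSolution (T : ℝ) (f : ℝ → L2) (y₀ : L2) (y : ℝ → L2) : Prop where
  memYT : MemYT T y
  weak_form : ∀ φ φt φx φxx : ℝ → L2, IsTestFunction T φ φt φx φxx → ∀ τ ∈ Icc 0 T,
    inner ℝ (y τ) (φ τ) - inner ℝ y₀ (φ 0) - ∫ t in 0..τ, inner ℝ (y t) (φt t + φxx t)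
      = ∫ t in 0..τ, inner ℝ (f t) (φ t)

end HeatControl

end

noncomputable section

namespace HeatControl

/-! In the Dirichlet sine basis the coefficients of `y` solve Y_n' = -μ_n Y_n + c_n u, Y_n(0) = 0,
where μ_n = ((n+1)π)² and c_n, the coefficient of the constant 1, satisfies c_n² μ_n ≤ 8. Parseval
reduces the three claims to bounds on partial sums S of ∫ Y_n², of μ_n ∫ Y_n², and of ∫ (Y_n - c_n
U)².

Each bound is a duality argument: if ∫ u φ = S and ‖φ‖² ≤ K S in H^s, then S ≤ K ‖u‖² in the dual
norm (`ofReal_le_dualENorm_sq`). The multiplier φ is a finite sum of solutions of E' = μ E - f, E(T)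
= 0, whose data f are the quantities to be estimated: Σ c_n E_n for H^1 and Σ μ_n c_n E_n for
H^(3/4), both with f = Y_n, and Σ c_n (E_n + ∫_T^t f) for H^(5/4), with f = Y_n - c_n U. The last
one has derivative Σ c_n μ_n E_n.

The L² norms of φ and φ' follow from the energy estimates for E and Cauchy–Schwarz with weights
(n+1)^(-2). The heart is the Gagliardo seminorm of Σ E_n (`gagliardoSq_sum_backward_le`). A step h
changes E_n, in L², by at most 2 min((n+1)^(-2), h) ‖f_n‖. Summing over n by Cauchy–Schwarz with
weights independent of h would need weights of order at least 1/(n+1), which are not summable. The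
weights used therefore depend on h: they concentrate near n+1 ~ h^(-1/2), and their sum stays at
most 1. -/

/-! ### Backward scalar problems and energy estimates. -/

/-- The solution of `E' = μ E - f` with `E T = 0`. -/
def backward (μ T : ℝ) (f : ℝ → ℝ) (t : ℝ) : ℝ :=
  -(Real.exp (μ * t) * ∫ s in T..t, Real.exp (-(μ * s)) * f s)

theorem backward_end (μ T : ℝ) (f : ℝ → ℝ) : backward μ T f T = 0 := by
  simp [backward]

theorem hasDerivAt_primitive {f : ℝ → ℝ} (hf : Continuous f) (a t : ℝ) :
    HasDerivAt (fun t => ∫ s in a..t, f s) (f t) t :=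
  intervalIntegral.integral_hasDerivAt_right (hf.intervalIntegrable _ _)
    hf.stronglyMeasurable.stronglyMeasurableAtFilter hf.continuousAt

theorem hasDerivAt_backward (μ T : ℝ) {f : ℝ → ℝ} (hf : Continuous f) (t : ℝ) :
    HasDerivAt (backward μ T f) (μ * backward μ T f t - f t) t := by
  have h1 : HasDerivAt (fun t => ∫ s in T..t, Real.exp (-(μ * s)) * f s)
      (Real.exp (-(μ * t)) * f t) t := hasDerivAt_primitive (by fun_prop) T t
  have h2 : HasDerivAt (fun t => Real.exp (μ * t)) (Real.exp (μ * t) * μ) t := by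
    simpa using ((hasDerivAt_id t).const_mul μ).exp
  have h3 : Real.exp (μ * t) * Real.exp (-(μ * t)) = 1 := by
    rw [← Real.exp_add]; simp
  refine (h2.mul h1).neg.congr_deriv ?_
  simp only [backward]
  linear_combination (-(f t)) * h3

theorem continuous_of_forall_hasDerivAt {g g' : ℝ → ℝ} (h : ∀ t, HasDerivAt g (g' t) t) :
    Continuous g :=
  continuous_iff_continuousAt.2 fun t => (h t).continuousAt

/-- The continuous solutions of the backward problem `E' = μ E - f`, `E T = 0`. -/
structure IsBackward (μ T : ℝ) (f E : ℝ → ℝ) : Prop where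
  cont : Continuous f
  deriv : ∀ t, HasDerivAt E (μ * E t - f t) t
  final : E T = 0

theorem isBackward_backward (μ T : ℝ) {f : ℝ → ℝ} (hf : Continuous f) :
    IsBackward μ T f (backward μ T f) :=
  ⟨hf, hasDerivAt_backward μ T hf, backward_end μ T f⟩

namespace IsBackward

variable {μ T : ℝ} {f E : ℝ → ℝ}

theorem continuous (h : IsBackward μ T f E) : Continuous E :=
  continuous_of_forall_hasDerivAt h.deriv

theorem continuous_deriv (h : IsBackward μ T f E) : Continuous fun t => μ * E t - f t :=
  (h.continuous.const_mul μ).sub h.cont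

theorem const_mul (h : IsBackward μ T f E) (c : ℝ) :
    IsBackward μ T (fun t => c * f t) (fun t => c * E t) where
  cont := h.cont.const_mul c
  deriv t := ((h.deriv t).const_mul c).congr_deriv (by ring)
  final := by simp [h.final]

theorem integral_deriv_sq (h : IsBackward μ T f E) :
    ∫ t in 0..T, 2 * E t * (μ * E t - f t) = - (E 0) ^ 2 := by
  have hc := h.continuous
  have hd := h.continuous_deriv
  rw [intervalIntegral.integral_eq_sub_of_hasDerivAt (f := fun t => E t ^ 2)
    (fun t _ => ((h.deriv t).pow 2).congr_deriv (by simp))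
    ((by fun_prop : Continuous fun t => 2 * E t * (μ * E t - f t)).intervalIntegrable _ _)]
  simp [h.final]

/-- Since f = μ E - E', expanding the square and integrating the cross term gives μ² ∫ E² + ∫ E'² +
μ E(0)² = ∫ f². All terms on the left are nonnegative; this estimate keeps the first, the next one
keeps the second. -/
theorem integral_sq_le (h : IsBackward μ T f E) (hT : 0 ≤ T) (hμ : 0 < μ) :
    μ ^ 2 * ∫ t in 0..T, E t ^ 2 ≤ ∫ t in 0..T, f t ^ 2 := by
  have hc := h.continuous
  have hd := h.continuous_deriv
  have hf := h.cont
  have h1 : ∫ t in 0..T, (μ ^ 2 * E t ^ 2 - f t ^ 2)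
      ≤ ∫ t in 0..T, μ * (2 * E t * (μ * E t - f t)) := by
    apply intervalIntegral.integral_mono_on hT
    · exact Continuous.intervalIntegrable (by fun_prop) _ _
    · exact Continuous.intervalIntegrable (by fun_prop) _ _
    · intro t _; nlinarith [sq_nonneg (μ * E t - f t)]
  rw [intervalIntegral.integral_const_mul, h.integral_deriv_sq, intervalIntegral.integral_sub,
    intervalIntegral.integral_const_mul] at h1
  · nlinarith [mul_nonneg hμ.le (sq_nonneg (E 0))]
  · exact Continuous.intervalIntegrable (by fun_prop) _ _
  · exact Continuous.intervalIntegrable (by fun_prop) _ _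

theorem integral_sq_deriv_le (h : IsBackward μ T f E) (hT : 0 ≤ T) (hμ : 0 < μ) :
    ∫ t in 0..T, (μ * E t - f t) ^ 2 ≤ ∫ t in 0..T, f t ^ 2 := by
  have hc := h.continuous
  have hd := h.continuous_deriv
  have hf := h.cont
  have h1 : ∫ t in 0..T, ((μ * E t - f t) ^ 2 - f t ^ 2)
      ≤ ∫ t in 0..T, μ * (2 * E t * (μ * E t - f t)) := by
    apply intervalIntegral.integral_mono_on hT
    · exact Continuous.intervalIntegrable (by fun_prop) _ _
    · exact Continuous.intervalIntegrable (by fun_prop) _ _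
    · intro t _; nlinarith [sq_nonneg (μ * E t)]
  rw [intervalIntegral.integral_const_mul, h.integral_deriv_sq, intervalIntegral.integral_sub] at h1
  · nlinarith [mul_nonneg hμ.le (sq_nonneg (E 0))]
  · exact Continuous.intervalIntegrable (by fun_prop) _ _
  · exact Continuous.intervalIntegrable (by fun_prop) _ _

end IsBackward

/-- A Poincaré inequality for functions that vanish at the right end point. -/
theorem integral_sq_le_of_hasDerivAt {g g' : ℝ → ℝ} {T : ℝ} (hT : 0 ≤ T)
    (hg : ∀ t, HasDerivAt g (g' t) t) (hg' : Continuous g') (hgT : g T = 0) :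
    ∫ t in 0..T, g t ^ 2 ≤ 4 * T ^ 2 * ∫ t in 0..T, g' t ^ 2 := by
  have hc := continuous_of_forall_hasDerivAt hg
  -- The integrand is (t g²)'; the factor t kills the boundary term at 0, and g(T) = 0 the other
  -- one.
  have h0 : ∫ t in 0..T, (g t ^ 2 + t * (2 * g t * g' t)) = 0 := by
    rw [intervalIntegral.integral_eq_sub_of_hasDerivAt (f := fun t => t * g t ^ 2)
      (fun t _ => ((hasDerivAt_id t).mul ((hg t).pow 2)).congr_deriv (by simp))
      ((by fun_prop : Continuous fun t => g t ^ 2 + t * (2 * g t * g' t)).intervalIntegrable _ _)]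
    simp [hgT]
  have h1 : ∫ t in 0..T, (g t ^ 2 - 4 * T ^ 2 * g' t ^ 2)
      ≤ ∫ t in 0..T, 2 * (g t ^ 2 + t * (2 * g t * g' t)) := by
    apply intervalIntegral.integral_mono_on hT
    · exact Continuous.intervalIntegrable (by fun_prop) _ _
    · exact Continuous.intervalIntegrable (by fun_prop) _ _
    · intro t ht
      have : t ^ 2 * g' t ^ 2 ≤ T ^ 2 * g' t ^ 2 := by
        have := pow_le_pow_left₀ ht.1 ht.2 2
        gcongr
      nlinarith [sq_nonneg (g t + 2 * t * g' t)]
  rw [intervalIntegral.integral_const_mul, h0, intervalIntegral.integral_sub,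
    intervalIntegral.integral_const_mul] at h1
  · linarith
  · exact Continuous.intervalIntegrable (by fun_prop) _ _
  · exact Continuous.intervalIntegrable (by fun_prop) _ _

/-! ### Time shifts in L². -/

/-- Cauchy–Schwarz, read off from the nonnegativity of the variance of g about its mean m. -/
theorem sq_integral_le {g : ℝ → ℝ} (hg : Continuous g) (x : ℝ) {h : ℝ} (hh : 0 < h) :
    (∫ t in x..x + h, g t) ^ 2 ≤ h * ∫ t in x..x + h, g t ^ 2 := by
  set m := (∫ t in x..x + h, g t) / h with hm
  have hI : ∫ t in x..x + h, g t = h * m := by rw [hm]; field_simp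
  have h0 : 0 ≤ ∫ t in x..x + h, (g t - m) ^ 2 :=
    intervalIntegral.integral_nonneg (by linarith) fun t _ => sq_nonneg _
  have h1 : ∫ t in x..x + h, (g t - m) ^ 2
      = ∫ t in x..x + h, (g t ^ 2 - (2 * m) * g t + m ^ 2) := by
    congr 1; ext t; ring
  have i1 : IntervalIntegrable (fun t => g t ^ 2) volume x (x + h) :=
    (hg.pow 2).intervalIntegrable _ _
  have i2 : IntervalIntegrable (fun t => 2 * m * g t) volume x (x + h) :=
    (hg.const_mul _).intervalIntegrable _ _
  rw [h1, intervalIntegral.integral_add (i1.sub i2) (by simp), intervalIntegral.integral_sub i1 i2,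
    intervalIntegral.integral_const_mul, hI, intervalIntegral.integral_const] at h0
  simp only [add_sub_cancel_left, smul_eq_mul] at h0
  rw [hI]
  nlinarith

/-- With G the primitive of g'², Cauchy–Schwarz bounds the squared increment by h (G(x+h) - G(x)).
Integrating this difference in x leaves only two end intervals of length h, hence at most h G(T); no
double integral has to be swapped. -/
theorem integral_shift_sq_le {g g' : ℝ → ℝ} {T h : ℝ} (hh : 0 < h) (hhT : h < T)
    (hg : ∀ t, HasDerivAt g (g' t) t) (hg' : Continuous g') :
    ∫ x in 0..T - h, (g (x + h) - g x) ^ 2 ≤ h ^ 2 * ∫ t in 0..T, g' t ^ 2 := by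
  have hc := continuous_of_forall_hasDerivAt hg
  set G : ℝ → ℝ := fun x => ∫ t in 0..x, g' t ^ 2 with hG
  have hGd : ∀ x, HasDerivAt G (g' x ^ 2) x := hasDerivAt_primitive (hg'.pow 2) 0
  have hGc : Continuous G := continuous_of_forall_hasDerivAt hGd
  have i : ∀ a b, IntervalIntegrable (fun t => g' t ^ 2) volume a b :=
    (hg'.pow 2).intervalIntegrable
  have hsub : ∀ a b, G b - G a = ∫ t in a..b, g' t ^ 2 := fun a b =>
    intervalIntegral.integral_interval_sub_left (i _ _) (i _ _)
  have hmono : Monotone G := fun a b hab => by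
    have : 0 ≤ G b - G a := by
      rw [hsub]; exact intervalIntegral.integral_nonneg hab fun t _ => sq_nonneg _
    linarith
  have hG0 : G 0 = 0 := by simp [hG]
  have iG : ∀ a b, IntervalIntegrable G volume a b := hGc.intervalIntegrable
  have h1 : ∫ x in 0..T - h, (g (x + h) - g x) ^ 2 ≤ ∫ x in 0..T - h, h * (G (x + h) - G x) := by
    apply intervalIntegral.integral_mono_on (by linarith)
    · exact Continuous.intervalIntegrable (by fun_prop) _ _
    · exact Continuous.intervalIntegrable (by fun_prop) _ _
    · intro x _
      rw [hsub, ← intervalIntegral.integral_eq_sub_of_hasDerivAt (fun t _ => hg t)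
        (hg'.intervalIntegrable _ _)]
      exact sq_integral_le hg' x hh
  have h2 : ∫ x in 0..T - h, G (x + h) = ∫ x in h..T, G x := by
    rw [intervalIntegral.integral_comp_add_right]; simp
  have h3 : ∫ x in 0..T - h, (G (x + h) - G x) ≤ h * G T := by
    rw [intervalIntegral.integral_sub
      ((by fun_prop : Continuous fun x => G (x + h)).intervalIntegrable _ _) (iG _ _), h2]
    have e1 := intervalIntegral.integral_add_adjacent_intervals (iG 0 h) (iG h T)
    have e2 := intervalIntegral.integral_add_adjacent_intervals (iG 0 (T - h)) (iG (T - h) T)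
    have e3 : 0 ≤ ∫ x in 0..h, G x := intervalIntegral.integral_nonneg hh.le fun t ht => by
      rw [← hG0]; exact hmono ht.1
    have e4 : ∫ x in T - h..T, G x ≤ ∫ x in T - h..T, G T :=
      intervalIntegral.integral_mono_on (by linarith) (iG _ _) (by simp) fun t ht => hmono ht.2
    simp only [intervalIntegral.integral_const, sub_sub_cancel, smul_eq_mul] at e4
    linarith
  rw [intervalIntegral.integral_const_mul] at h1
  nlinarith

theorem integral_shift_sq_le_integral_sq {g : ℝ → ℝ} {T h : ℝ} (hh : 0 < h) (hhT : h < T)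
    (hg : Continuous g) :
    ∫ x in 0..T - h, (g (x + h) - g x) ^ 2 ≤ 4 * ∫ t in 0..T, g t ^ 2 := by
  have i : ∀ a b, IntervalIntegrable (fun t => g t ^ 2) volume a b :=
    (hg.pow 2).intervalIntegrable
  have h1 : ∫ x in 0..T - h, (g (x + h) - g x) ^ 2
      ≤ ∫ x in 0..T - h, (2 * g (x + h) ^ 2 + 2 * g x ^ 2) := by
    apply intervalIntegral.integral_mono_on (by linarith)
    · exact Continuous.intervalIntegrable (by fun_prop) _ _
    · exact Continuous.intervalIntegrable (by fun_prop) _ _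
    · intro x _; nlinarith [sq_nonneg (g (x + h) + g x)]
  have h2 : ∫ x in 0..T - h, g (x + h) ^ 2 = ∫ x in h..T, g x ^ 2 := by
    rw [intervalIntegral.integral_comp_add_right (fun x => g x ^ 2)]; simp
  rw [intervalIntegral.integral_add (Continuous.intervalIntegrable (by fun_prop) _ _)
    (Continuous.intervalIntegrable (by fun_prop) _ _), intervalIntegral.integral_const_mul,
    intervalIntegral.integral_const_mul, h2] at h1
  have e1 := intervalIntegral.integral_add_adjacent_intervals (i 0 h) (i h T)
  have e2 := intervalIntegral.integral_add_adjacent_intervals (i 0 (T - h)) (i (T - h) T)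
  have e3 : 0 ≤ ∫ x in 0..h, g x ^ 2 :=
    intervalIntegral.integral_nonneg hh.le fun t _ => sq_nonneg _
  have e4 : 0 ≤ ∫ x in T - h..T, g x ^ 2 :=
    intervalIntegral.integral_nonneg (by linarith) fun t _ => sq_nonneg _
  linarith

/-- Short steps see the derivative of E, bounded by f in L²; long steps see only the size of E, at
most k^(-2) times that of f. The two regimes meet at h = k^(-2). -/
theorem IsBackward.integral_shift_sq_le {μ T h k : ℝ} {f E : ℝ → ℝ} (H : IsBackward μ T f E)
    (hk : 0 < k) (hμ : k ^ 2 ≤ μ) (hh : 0 < h) (hhT : h < T) :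
    ∫ x in 0..T - h, (E (x + h) - E x) ^ 2
      ≤ 4 * min ((k ^ 2)⁻¹) h ^ 2 * ∫ t in 0..T, f t ^ 2 := by
  have hμ0 : 0 < μ := lt_of_lt_of_le (by positivity) hμ
  have hT : 0 ≤ T := by linarith
  have hS : 0 ≤ ∫ t in 0..T, f t ^ 2 :=
    intervalIntegral.integral_nonneg hT fun t _ => sq_nonneg _
  rcases min_choice ((k ^ 2)⁻¹) h with hm | hm <;> rw [hm]
  · have h1 := integral_shift_sq_le_integral_sq hh hhT H.continuous
    have h2 := H.integral_sq_le hT hμ0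
    have h0 : 0 ≤ ∫ t in 0..T, E t ^ 2 :=
      intervalIntegral.integral_nonneg hT fun t _ => sq_nonneg _
    have h3 : (k ^ 2) ^ 2 * ∫ t in 0..T, E t ^ 2 ≤ ∫ t in 0..T, f t ^ 2 :=
      (mul_le_mul_of_nonneg_right (pow_le_pow_left₀ (by positivity) hμ 2) h0).trans h2
    have h4 : ∫ t in 0..T, E t ^ 2 ≤ ((k ^ 2)⁻¹) ^ 2 * ∫ t in 0..T, f t ^ 2 := by
      rw [inv_pow, inv_mul_eq_div, le_div_iff₀ (by positivity)]; linarith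
    linarith
  · have h1 := HeatControl.integral_shift_sq_le hh hhT H.deriv H.continuous_deriv
    have h2 := H.integral_sq_deriv_le hT hμ0
    have := mul_le_mul_of_nonneg_left h2 (sq_nonneg h)
    nlinarith [mul_nonneg (sq_nonneg h) hS]

/-! ### Step-dependent weights and the frequency kernel. -/

/-- A family of positive weights with sum at most `1`, of size `r min((k r)^(-1/2), (k r)^(-3/2))`
at the frequency `k = n + 1`. -/
def weight (r : ℝ) (n : ℕ) : ℝ :=
  (1 + √(n * r))⁻¹ - (1 + √((n + 1 : ℕ) * r))⁻¹

/-- With a = √(n r) and b = √((n+1) r) one has b² - a² = r, so the weight equals r /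
((a+b)(1+a)(1+b)), and a ≤ b. -/
theorem weight_lower {r : ℝ} (hr : 0 < r) (n : ℕ) :
    r / (2 * √((n + 1 : ℕ) * r) * (1 + √((n + 1 : ℕ) * r)) ^ 2) ≤ weight r n := by
  have ha : 0 ≤ √(n * r) := Real.sqrt_nonneg _
  have hb : 0 < √((n + 1 : ℕ) * r) := Real.sqrt_pos.2 (by positivity)
  have hab : √(n * r) ≤ √((n + 1 : ℕ) * r) := Real.sqrt_le_sqrt (by push_cast; nlinarith)
  have ha2 : √(n * r) ^ 2 = n * r := Real.sq_sqrt (by positivity)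
  have hb2 : √((n + 1 : ℕ) * r) ^ 2 = (n + 1 : ℕ) * r := Real.sq_sqrt (by positivity)
  unfold weight
  set a := √(n * r)
  set b := √((n + 1 : ℕ) * r)
  have hr' : r = (b - a) * (b + a) := by
    have : b ^ 2 - a ^ 2 = r := by rw [ha2, hb2]; push_cast; ring
    linarith
  have e : (1 + a)⁻¹ - (1 + b)⁻¹ = (b - a) / ((1 + a) * (1 + b)) := by
    field_simp; ring
  rw [e, hr', div_le_div_iff₀ (by positivity) (by positivity)]
  have h1 : (b + a) * (1 + a) ≤ 2 * b * (1 + b) := by nlinarith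
  have h2 : 0 ≤ (b - a) * (1 + b) := mul_nonneg (by linarith) (by linarith)
  nlinarith [mul_le_mul_of_nonneg_left h1 h2]

theorem weight_pos {r : ℝ} (hr : 0 < r) (n : ℕ) : 0 < weight r n := by
  have hb : 0 < √((n + 1 : ℕ) * r) := Real.sqrt_pos.2 (by positivity)
  exact lt_of_lt_of_le (by positivity) (weight_lower hr n)

/-- The weights telescope, so the bound is uniform in r; this is what permits choosing r as a
function of the step. -/
theorem sum_weight_le_one (r : ℝ) (N : ℕ) : ∑ n ∈ Finset.range N, weight r n ≤ 1 := by
  unfold weight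
  rw [Finset.sum_range_sub']
  have : 0 ≤ (1 + √(N * r))⁻¹ := by positivity
  simpa using this

theorem inv_weight_le {r : ℝ} (hr : 0 < r) (n : ℕ) :
    (weight r n)⁻¹ ≤ 2 * √((n + 1 : ℕ) * r) * (1 + √((n + 1 : ℕ) * r)) ^ 2 / r := by
  have hb : 0 < √((n + 1 : ℕ) * r) := Real.sqrt_pos.2 (by positivity)
  rw [← inv_div]
  exact inv_anti₀ (by positivity) (weight_lower hr n)

theorem sq_sum_le_sum_sq_div {N : ℕ} {p : ℕ → ℝ} (hp : ∀ n, 0 < p n) {S : ℝ}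
    (hS : ∑ n ∈ Finset.range N, p n ≤ S) (d : ℕ → ℝ) :
    (∑ n ∈ Finset.range N, d n) ^ 2 ≤ S * ∑ n ∈ Finset.range N, d n ^ 2 / p n := by
  have h1 := Finset.sq_sum_div_le_sum_sq_div (Finset.range N) d (fun n _ => hp n)
  have h2 : 0 ≤ ∑ n ∈ Finset.range N, d n ^ 2 / p n :=
    Finset.sum_nonneg fun n _ => div_nonneg (sq_nonneg _) (hp n).le
  rcases (Finset.range N).eq_empty_or_nonempty with h | h
  · simp [h]
  have h3 : 0 < ∑ n ∈ Finset.range N, p n := Finset.sum_pos (fun n _ => hp n) h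
  rw [div_le_iff₀ h3, mul_comm] at h1
  exact h1.trans (mul_le_mul_of_nonneg_right hS h2)

/-- The kernel that controls the contribution of the frequency `n + 1` to the difference of step
`h`. -/
def freqKernel (n : ℕ) (h : ℝ) : ℝ :=
  if h ≤ (((n + 1 : ℕ) : ℝ) ^ 2)⁻¹ then
    32 * ((n + 1 : ℕ) : ℝ) ^ (1 / 2 : ℝ) * h ^ (7 / 4 : ℝ)
  else 32 * ((n + 1 : ℕ) : ℝ) ^ (-5 / 2 : ℝ) * h ^ (1 / 4 : ℝ)

/-- The choice r = √h puts the transition of the weight, k r = 1, exactly at the transition h =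
k^(-2) of the shift estimate. -/
theorem min_sq_div_weight_le {h : ℝ} (hh : 0 < h) (n : ℕ) :
    4 * min ((((n + 1 : ℕ) : ℝ) ^ 2)⁻¹) h ^ 2 / weight √h n ≤ freqKernel n h := by
  have hr : 0 < √h := Real.sqrt_pos.2 hh
  have hk : (0 : ℝ) < ((n + 1 : ℕ) : ℝ) := by positivity
  have hw := inv_weight_le hr n
  unfold freqKernel
  set k : ℝ := ((n + 1 : ℕ) : ℝ) with hkd
  have hx : 0 < k * √h := by positivity
  set b := √(k * √h) with hb
  have hb0 : 0 < b := Real.sqrt_pos.2 hx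
  have hbk : b = k ^ (1 / 2 : ℝ) * h ^ (1 / 4 : ℝ) := by
    rw [hb, Real.sqrt_eq_rpow, Real.sqrt_eq_rpow, Real.mul_rpow hk.le (by positivity),
      ← Real.rpow_mul hh.le]
    norm_num
  have hsq : √h = h ^ (1 / 2 : ℝ) := Real.sqrt_eq_rpow h
  have key : ∀ m B : ℝ, 0 ≤ m → (1 + b) ^ 2 ≤ B →
      4 * m ^ 2 / weight √h n ≤ 4 * m ^ 2 * (2 * b * B / √h) := by
    intro m B hm hB
    rw [div_eq_mul_inv]
    refine mul_le_mul_of_nonneg_left (hw.trans ?_) (by positivity)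
    gcongr
  -- The factor (1+b)² is at most 4 for b ≤ 1 and at most 4 b² for b ≥ 1; with the 4 of the shift
  -- estimate and the 2 of `inv_weight_le` this gives 4 · 2 · 4 = 32.
  split_ifs with hc
  · have hx1 : b ≤ 1 := by
      refine Real.sqrt_le_one.2 ?_
      have : (k * √h) ^ 2 ≤ 1 := by
        rw [mul_pow, Real.sq_sqrt hh.le]
        calc k ^ 2 * h ≤ k ^ 2 * (k ^ 2)⁻¹ := by gcongr
          _ = 1 := by field_simp
      nlinarith
    rw [min_eq_right hc]
    refine (key h 4 hh.le (by nlinarith)).trans (le_of_eq ?_)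
    rw [hbk, hsq]
    have : h ^ (7 / 4 : ℝ) * h ^ (1 / 2 : ℝ) = h ^ 2 * h ^ (1 / 4 : ℝ) := by
      rw [← Real.rpow_natCast, ← Real.rpow_add hh, ← Real.rpow_add hh]; norm_num
    field_simp
    linear_combination (-32) * this
  · push Not at hc
    have hx1 : 1 ≤ b := by
      rw [hb, Real.one_le_sqrt]
      have : 1 ≤ (k * √h) ^ 2 := by
        rw [mul_pow, Real.sq_sqrt hh.le]
        calc (1 : ℝ) = k ^ 2 * (k ^ 2)⁻¹ := by field_simp
          _ ≤ k ^ 2 * h := by gcongr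
      nlinarith
    rw [min_eq_left hc.le]
    refine (key _ (4 * b ^ 2) (by positivity) (by nlinarith)).trans (le_of_eq ?_)
    have e1 : b ^ 2 = k * √h := Real.sq_sqrt hx.le
    have e2 : k ^ (-(5 / 2) : ℝ) * k ^ 3 = k ^ (1 / 2 : ℝ) := by
      rw [← Real.rpow_natCast, ← Real.rpow_add hk]; norm_num
    rw [e1, hbk]
    field_simp
    linear_combination (-32) * e2

theorem lintegral_Ioc_rpow {c : ℝ} (hc : 0 < c) {a : ℝ} (ha : -1 < a) :
    ∫⁻ h in Ioc 0 c, ENNReal.ofReal (h ^ a) = ENNReal.ofReal (c ^ (a + 1) / (a + 1)) := by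
  have hi : IntervalIntegrable (fun h : ℝ => h ^ a) volume 0 c :=
    intervalIntegral.intervalIntegrable_rpow' ha
  rw [← ofReal_integral_eq_lintegral_ofReal
    ((intervalIntegrable_iff_integrableOn_Ioc_of_le hc.le).1 hi)
    ((ae_restrict_iff' measurableSet_Ioc).2 (ae_of_all _ fun h hh => Real.rpow_nonneg hh.1.le _)),
    ← intervalIntegral.integral_of_le hc.le, integral_rpow (Or.inl ha),
    Real.zero_rpow (by linarith), sub_zero]

theorem lintegral_Ioi_rpow {c : ℝ} (hc : 0 < c) {a : ℝ} (ha : a < -1) :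
    ∫⁻ h in Ioi c, ENNReal.ofReal (h ^ a) = ENNReal.ofReal (-c ^ (a + 1) / (a + 1)) := by
  rw [← ofReal_integral_eq_lintegral_ofReal (integrableOn_Ioi_rpow_of_lt ha hc)
    ((ae_restrict_iff' measurableSet_Ioi).2
      (ae_of_all _ fun h hh => Real.rpow_nonneg (hc.trans hh).le _)),
    integral_Ioi_rpow_of_lt ha hc]

/-- The constant in the estimate of the Gagliardo seminorm of order `(p - 1) / 2`. -/
def gagliardoConst (p : ℝ) : ℝ := 32 * ((11 / 4 - p)⁻¹ + (p - 5 / 4)⁻¹)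

theorem gagliardoConst_pos {p : ℝ} (hp1 : 5 / 4 < p) (hp2 : p < 11 / 4) :
    0 < gagliardoConst p := by
  have : 0 < 11 / 4 - p := by linarith
  have : 0 < p - 5 / 4 := by linarith
  unfold gagliardoConst; positivity

theorem measurable_freqKernel (n : ℕ) : Measurable (freqKernel n) := by
  unfold freqKernel
  exact Measurable.ite measurableSet_Iic (by fun_prop) (by fun_prop)

/-- Both pieces of the kernel are powers of h, and split at h = k^(-2) they scale like the same
power of k. Convergence at 0 requires p < 11/4 and at infinity p > 5/4. -/
theorem lintegral_freqKernel_le {p : ℝ} (hp1 : 5 / 4 < p) (hp2 : p < 11 / 4) (n : ℕ) :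
    ∫⁻ h in Ioi 0, ENNReal.ofReal (h ^ (-p) * freqKernel n h)
      ≤ ENNReal.ofReal (gagliardoConst p * ((n + 1 : ℕ) : ℝ) ^ (2 * p - 5)) := by
  have hk : (0 : ℝ) < ((n + 1 : ℕ) : ℝ) := by positivity
  have hq1 : 0 < 11 / 4 - p := by linarith
  have hq2 : 0 < p - 5 / 4 := by linarith
  unfold freqKernel
  set k : ℝ := ((n + 1 : ℕ) : ℝ) with hkd
  have hc : 0 < (k ^ 2)⁻¹ := by positivity
  have hck : (k ^ 2)⁻¹ = k ^ (-2 : ℝ) := by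
    rw [Real.rpow_neg hk.le]; norm_num
  rw [← Ioc_union_Ioi_eq_Ioi hc.le, lintegral_union measurableSet_Ioi Ioc_disjoint_Ioi_same]
  have h1 : ∫⁻ h in Ioc 0 (k ^ 2)⁻¹, ENNReal.ofReal (h ^ (-p) *
      if h ≤ (k ^ 2)⁻¹ then 32 * k ^ (1 / 2 : ℝ) * h ^ (7 / 4 : ℝ)
      else 32 * k ^ (-5 / 2 : ℝ) * h ^ (1 / 4 : ℝ))
      = ENNReal.ofReal (32 * (11 / 4 - p)⁻¹ * k ^ (2 * p - 5)) := by
    calc _ = ∫⁻ h in Ioc 0 (k ^ 2)⁻¹,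
          ENNReal.ofReal (32 * k ^ (1 / 2 : ℝ)) * ENNReal.ofReal (h ^ (7 / 4 - p)) := by
          refine setLIntegral_congr_fun measurableSet_Ioc fun h hh => ?_
          rw [if_pos hh.2, ← ENNReal.ofReal_mul (by positivity), sub_eq_add_neg,
            Real.rpow_add hh.1]
          ring_nf
      _ = _ := by
          rw [lintegral_const_mul' _ _ ENNReal.ofReal_ne_top,
            lintegral_Ioc_rpow hc (by linarith),
            ← ENNReal.ofReal_mul (by positivity), hck, ← Real.rpow_mul hk.le]
          congr 1
          rw [show 2 * p - 5 = 1 / 2 + -2 * (7 / 4 - p + 1) by ring, Real.rpow_add hk,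
            show 7 / 4 - p + 1 = 11 / 4 - p by ring]
          ring
  have h2 : ∫⁻ h in Ioi (k ^ 2)⁻¹, ENNReal.ofReal (h ^ (-p) *
      if h ≤ (k ^ 2)⁻¹ then 32 * k ^ (1 / 2 : ℝ) * h ^ (7 / 4 : ℝ)
      else 32 * k ^ (-5 / 2 : ℝ) * h ^ (1 / 4 : ℝ))
      = ENNReal.ofReal (32 * (p - 5 / 4)⁻¹ * k ^ (2 * p - 5)) := by
    calc _ = ∫⁻ h in Ioi (k ^ 2)⁻¹,
          ENNReal.ofReal (32 * k ^ (-5 / 2 : ℝ)) * ENNReal.ofReal (h ^ (1 / 4 - p)) := by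
          refine setLIntegral_congr_fun measurableSet_Ioi fun h hh => ?_
          rw [if_neg (not_le.2 hh), ← ENNReal.ofReal_mul (by positivity), sub_eq_add_neg,
            Real.rpow_add (hc.trans hh)]
          ring_nf
      _ = _ := by
          rw [lintegral_const_mul' _ _ ENNReal.ofReal_ne_top,
            lintegral_Ioi_rpow hc (by linarith),
            ← ENNReal.ofReal_mul (by positivity), hck, ← Real.rpow_mul hk.le]
          congr 1
          rw [show 2 * p - 5 = -5 / 2 + -2 * (1 / 4 - p + 1) by ring, Real.rpow_add hk,
            show 1 / 4 - p + 1 = -(p - 5 / 4) by ring, neg_div_neg_eq]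
          ring
  rw [h1, h2, ← ENNReal.ofReal_add (by positivity) (by positivity)]
  unfold gagliardoConst
  apply le_of_eq; congr 1; ring

/-! ### The Gagliardo seminorm through time shifts. -/

theorem lintegral_eq_two_mul_of_even {M : ℝ → ℝ≥0∞} (hM : ∀ h, M (-h) = M h) :
    ∫⁻ h, M h = 2 * ∫⁻ h in Ioi 0, M h := by
  rw [← lintegral_add_compl M (measurableSet_Ioi (a := (0 : ℝ))), compl_Ioi,
    setLIntegral_congr Iio_ae_eq_Iic.symm, two_mul]
  congr 1
  rw [← (Measure.measurePreserving_neg (volume : Measure ℝ)).setLIntegral_comp_preimage_emb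
    (MeasurableEquiv.neg ℝ).measurableEmbedding M (Iio 0)]
  simp [hM]

/-- Substitute z = x + h and swap the integrals; the result is even in h, whence the factor 2 and
the restriction to h > 0. -/
theorem gagliardoSq_le {T σ : ℝ} {φ : ℝ → ℝ} (hφ : Continuous φ) :
    gagliardoSq 0 T σ φ ≤ 2 * ∫⁻ h in Ioo 0 T,
      ENNReal.ofReal (h ^ (-(1 + 2 * σ)) * ∫ x in 0..T - h, (φ (x + h) - φ x) ^ 2) := by
  set I : ℝ → ℝ≥0∞ := (Ioo 0 T).indicator 1 with hI
  have hIm : Measurable I := measurable_one.indicator measurableSet_Ioo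
  -- Both indicators are put into the integrand, so that L is symmetric and the integrals run over
  -- the whole line, where translation is free.
  set L : ℝ → ℝ → ℝ≥0∞ := fun x z =>
    I x * (I z * (‖φ x - φ z‖ₑ ^ 2 / ‖x - z‖ₑ ^ (1 + 2 * σ))) with hL
  have hLs : ∀ x z, L x z = L z x := fun x z => by
    simp only [hL, enorm_sub_rev (φ x), enorm_sub_rev x]; ring
  have hφm := hφ.measurable
  have e1 : gagliardoSq 0 T σ φ = ∫⁻ x, ∫⁻ z, L x z := by
    unfold gagliardoSq
    rw [← lintegral_indicator measurableSet_Ioo]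
    congr 1; ext x
    simp only [hL, hI]
    by_cases hx : x ∈ Ioo 0 T
    · rw [indicator_of_mem hx, ← lintegral_indicator measurableSet_Ioo]
      simp only [hx, indicator_of_mem, Pi.one_apply, one_mul]
      congr 1; ext z
      by_cases hz : z ∈ Ioo 0 T <;> simp [hz]
    · simp [hx]
  have e2 : ∫⁻ x, ∫⁻ z, L x z = ∫⁻ h, ∫⁻ x, L x (x + h) := by
    rw [← lintegral_lintegral_swap (f := fun x h => L x (x + h))]
    · congr 1; ext x
      exact (lintegral_add_left_eq_self (L x) x).symm
    · apply Measurable.aemeasurable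
      simp only [hL, Function.uncurry_def]
      fun_prop
  have hev : ∀ h, ∫⁻ x, L x (x + -h) = ∫⁻ x, L x (x + h) := fun h => by
    rw [← lintegral_add_right_eq_self _ h]
    congr 1; ext x
    rw [hLs]; simp
  rw [e1, e2, lintegral_eq_two_mul_of_even hev]
  gcongr 2 * ?_
  rw [← lintegral_indicator measurableSet_Ioi, ← lintegral_indicator measurableSet_Ioo]
  apply lintegral_mono
  intro h
  by_cases h0 : 0 < h
  swap
  · simp [h0]
  rw [indicator_of_mem (by exact h0)]
  by_cases hhT : h < T
  · rw [indicator_of_mem (by exact ⟨h0, hhT⟩)]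
    have hp : 0 ≤ h ^ (-(1 + 2 * σ)) := Real.rpow_nonneg h0.le _
    rw [ENNReal.ofReal_mul hp, intervalIntegral.integral_of_le (by linarith),
      ofReal_integral_eq_lintegral_ofReal
        ((Continuous.integrableOn_Icc (by fun_prop)).mono_set Ioc_subset_Icc_self)
        (ae_of_all _ fun x => sq_nonneg _), ← lintegral_const_mul' _ _ ENNReal.ofReal_ne_top,
      ← lintegral_indicator measurableSet_Ioc]
    apply lintegral_mono
    intro x
    simp only [hL, hI]
    by_cases hx : x ∈ Ioo 0 T
    swap
    · simp [hx]
    by_cases hxh : x + h ∈ Ioo 0 T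
    swap
    · simp [hxh]
    rw [indicator_of_mem (s := Ioc 0 (T - h)) ⟨hx.1, by linarith [hxh.2]⟩]
    simp only [hx, hxh, indicator_of_mem, Pi.one_apply, one_mul, sub_add_cancel_left, enorm_neg]
    rw [div_eq_mul_inv, mul_comm, ← ENNReal.rpow_neg, Real.enorm_of_nonneg h0.le,
      ENNReal.ofReal_rpow_of_pos h0, enorm_sub_rev,
      ← ofReal_norm, ← ENNReal.ofReal_pow (norm_nonneg _), Real.norm_eq_abs, sq_abs]
  · refine le_trans (le_of_eq ?_) zero_le
    rw [lintegral_eq_zero_iff' (by apply Measurable.aemeasurable; simp only [hL]; fun_prop)]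
    refine ae_of_all _ fun x => ?_
    simp only [hL, hI, Pi.zero_apply]
    by_cases hx : x ∈ Ioo 0 T
    · have : x + h ∉ Ioo 0 T := fun hc => by linarith [hx.1, hc.2]
      simp [this]
    · simp [hx]

/-- The Gagliardo seminorm of a sum of solutions of backward problems whose rates grow like the
squares of the integers. -/
theorem gagliardoSq_sum_backward_le {T σ : ℝ} (hT : 0 < T) (hσ1 : 1 / 8 < σ) (hσ2 : σ < 7 / 8)
    {N : ℕ} {μ : ℕ → ℝ} {f E : ℕ → ℝ → ℝ} (hμ : ∀ n, ((n + 1 : ℕ) : ℝ) ^ 2 ≤ μ n)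
    (H : ∀ n, IsBackward (μ n) T (f n) (E n)) :
    gagliardoSq 0 T σ (fun t => ∑ n ∈ Finset.range N, E n t)
      ≤ ENNReal.ofReal (2 * gagliardoConst (1 + 2 * σ) * ∑ n ∈ Finset.range N,
        ((n + 1 : ℕ) : ℝ) ^ (4 * σ - 3) * ∫ t in 0..T, f n t ^ 2) := by
  have hEc : ∀ n, Continuous (E n) := fun n => (H n).continuous
  have hC := gagliardoConst_pos (p := 1 + 2 * σ) (by linarith) (by linarith)
  have hA : ∀ n, 0 ≤ ∫ t in 0..T, f n t ^ 2 := fun n =>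
    intervalIntegral.integral_nonneg hT.le fun t _ => sq_nonneg _
  have hKnn : ∀ n, ∀ h > 0, 0 ≤ freqKernel n h := fun n h hh =>
    le_trans (div_nonneg (by positivity) (weight_pos (Real.sqrt_pos.2 hh) n).le)
      (min_sq_div_weight_le hh n)
  refine (gagliardoSq_le (by fun_prop)).trans ?_
  calc 2 * ∫⁻ h in Ioo 0 T, ENNReal.ofReal (h ^ (-(1 + 2 * σ)) * ∫ x in 0..T - h,
          (∑ n ∈ Finset.range N, E n (x + h) - ∑ n ∈ Finset.range N, E n x) ^ 2)
      ≤ 2 * ∫⁻ h in Ioo 0 T, ∑ n ∈ Finset.range N,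
          ENNReal.ofReal (h ^ (-(1 + 2 * σ)) * freqKernel n h)
            * ENNReal.ofReal (∫ t in 0..T, f n t ^ 2) := by
        gcongr 2 * ?_
        refine setLIntegral_mono' measurableSet_Ioo fun h hh => ?_
        have hp : 0 ≤ h ^ (-(1 + 2 * σ)) := Real.rpow_nonneg hh.1.le _
        have hr : 0 < √h := Real.sqrt_pos.2 hh.1
        -- Cauchy–Schwarz over the frequencies, with weights adapted to the current step h.
        have h1 : ∫ x in 0..T - h,
            (∑ n ∈ Finset.range N, E n (x + h) - ∑ n ∈ Finset.range N, E n x) ^ 2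
            ≤ ∫ x in 0..T - h, ∑ n ∈ Finset.range N, (E n (x + h) - E n x) ^ 2 / weight √h n := by
          apply intervalIntegral.integral_mono_on (by linarith [hh.2])
          · exact Continuous.intervalIntegrable (by fun_prop) _ _
          · exact Continuous.intervalIntegrable (by fun_prop) _ _
          · intro x _
            rw [← Finset.sum_sub_distrib, ← one_mul (∑ n ∈ Finset.range N, _ / _)]
            exact sq_sum_le_sum_sq_div (weight_pos hr) (sum_weight_le_one _ N) _
        have h2 : ∫ x in 0..T - h, ∑ n ∈ Finset.range N, (E n (x + h) - E n x) ^ 2 / weight √h n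
            ≤ ∑ n ∈ Finset.range N, freqKernel n h * ∫ t in 0..T, f n t ^ 2 := by
          rw [intervalIntegral.integral_finsetSum fun n _ =>
            Continuous.intervalIntegrable (by fun_prop) _ _]
          refine Finset.sum_le_sum fun n _ => ?_
          rw [intervalIntegral.integral_div, div_le_iff₀ (weight_pos hr n)]
          have h3 := (H n).integral_shift_sq_le (by positivity) (hμ n) hh.1 hh.2
          have h4 := min_sq_div_weight_le hh.1 n
          rw [div_le_iff₀ (weight_pos hr n)] at h4
          nlinarith [mul_le_mul_of_nonneg_right h4 (hA n)]
        calc _ ≤ ENNReal.ofReal (h ^ (-(1 + 2 * σ)) *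
              ∑ n ∈ Finset.range N, freqKernel n h * ∫ t in 0..T, f n t ^ 2) :=
              ENNReal.ofReal_le_ofReal (mul_le_mul_of_nonneg_left (h1.trans h2) hp)
          _ = _ := by
              rw [Finset.mul_sum, ENNReal.ofReal_sum_of_nonneg fun n _ =>
                mul_nonneg hp (mul_nonneg (hKnn n h hh.1) (hA n))]
              refine Finset.sum_congr rfl fun n _ => ?_
              rw [← ENNReal.ofReal_mul (mul_nonneg hp (hKnn n h hh.1)), mul_assoc]
    _ ≤ 2 * ∑ n ∈ Finset.range N, (∫⁻ h in Ioi 0,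
          ENNReal.ofReal (h ^ (-(1 + 2 * σ)) * freqKernel n h))
            * ENNReal.ofReal (∫ t in 0..T, f n t ^ 2) := by
        have hm : ∀ n, Measurable fun h : ℝ =>
            ENNReal.ofReal (h ^ (-(1 + 2 * σ)) * freqKernel n h) := fun n => by
          have := measurable_freqKernel n
          fun_prop
        rw [lintegral_finsetSum _ fun n _ => (hm n).mul_const _]
        gcongr with n _
        rw [lintegral_mul_const _ (hm n)]
        gcongr
        exact Ioo_subset_Ioi_self
    _ ≤ 2 * ∑ n ∈ Finset.range N, ENNReal.ofReal (gagliardoConst (1 + 2 * σ) *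
          ((n + 1 : ℕ) : ℝ) ^ (2 * (1 + 2 * σ) - 5)) * ENNReal.ofReal (∫ t in 0..T, f n t ^ 2) := by
        gcongr with n _
        exact lintegral_freqKernel_le (by linarith) (by linarith) n
    _ = _ := by
        rw [mul_assoc 2, ENNReal.ofReal_mul zero_le_two, ENNReal.ofReal_ofNat]
        congr 1
        rw [Finset.mul_sum, ENNReal.ofReal_sum_of_nonneg fun n _ => by have := hA n; positivity]
        refine Finset.sum_congr rfl fun n _ => ?_
        rw [← ENNReal.ofReal_mul (by positivity), show 2 * (1 + 2 * σ) - 5 = 4 * σ - 3 by ring,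
          mul_assoc]

/-! ### Weak derivatives, Sobolev norms and the dual norm. -/

section WeakDeriv

variable {E : Type*} [NormedAddCommGroup E] [NormedSpace ℝ E] [CompleteSpace E] {a b : ℝ}

theorem HasWeakDeriv.congr {f g f' g' : ℝ → E} (h : HasWeakDeriv a b f g)
    (hf : f =ᵐ[volume.restrict (Ioo a b)] f') (hg : g =ᵐ[volume.restrict (Ioo a b)] g') :
    HasWeakDeriv a b f' g' := by
  obtain ⟨h1, h2, h3⟩ := h
  refine ⟨?_, ?_, fun η hη hc hs => ?_⟩
  · exact h1.congr hf
  · exact h2.congr hg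
  · have e1 : ∫ x in Ioo a b, deriv η x • f' x = ∫ x in Ioo a b, deriv η x • f x :=
      integral_congr_ae (by filter_upwards [hf] with x hx; rw [hx])
    have e2 : ∫ x in Ioo a b, η x • g' x = ∫ x in Ioo a b, η x • g x :=
      integral_congr_ae (by filter_upwards [hg] with x hx; rw [hx])
    rw [e1, e2, h3 η hη hc hs]

theorem HasWeakDeriv.const_smul {f g : ℝ → E} (h : HasWeakDeriv a b f g) (c : ℝ) :
    HasWeakDeriv a b (c • f) (c • g) := by
  obtain ⟨h1, h2, h3⟩ := h
  refine ⟨h1.smul c, h2.smul c, fun η hη hc hs => ?_⟩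
  simp only [Pi.smul_apply, smul_comm _ c, integral_smul, h3 η hη hc hs, smul_neg]

theorem hasWeakDeriv_of_hasDerivAt (hab : a ≤ b) {f f' : ℝ → E} (hf : ∀ x, HasDerivAt f (f' x) x)
    (hf' : Continuous f') : HasWeakDeriv a b f f' := by
  have hc : Continuous f := continuous_iff_continuousAt.2 fun t => (hf t).continuousAt
  refine ⟨hc.locallyIntegrable.locallyIntegrableOn _, hf'.locallyIntegrable.locallyIntegrableOn _,
    fun η hη hcs hs => ?_⟩
  have hηd : ∀ x, HasDerivAt η (deriv η x) x := fun x =>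
    (hη.differentiable (by simp) x).hasDerivAt
  have hηc : Continuous (deriv η) := hη.continuous_deriv (by simp)
  have hη0 : ∀ x, x ∉ Ioo a b → η x = 0 := fun x hx =>
    image_eq_zero_of_notMem_tsupport fun h => hx (hs h)
  have h0 : ∫ x in a..b, (η x • f' x + deriv η x • f x) = η b • f b - η a • f a := by
    refine intervalIntegral.integral_eq_sub_of_hasDerivAt
      (fun x _ => (hηd x).smul (hf x)) (Continuous.intervalIntegrable ?_ _ _)
    have := hη.continuous
    fun_prop
  have hηc' := hη.continuous
  rw [hη0 a (by simp), hη0 b (by simp), intervalIntegral.integral_add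
    (Continuous.intervalIntegrable (by fun_prop) _ _)
    (Continuous.intervalIntegrable (by fun_prop) _ _)] at h0
  rw [← integral_Ioc_eq_integral_Ioo, ← integral_Ioc_eq_integral_Ioo,
    ← intervalIntegral.integral_of_le hab, ← intervalIntegral.integral_of_le hab]
  simp only [zero_smul, sub_zero] at h0
  exact eq_neg_of_add_eq_zero_right h0

end WeakDeriv

theorem memLp_Ioo_of_continuous {f : ℝ → ℝ} (hf : Continuous f) (a b : ℝ) :
    MemLp f 2 (volume.restrict (Ioo a b)) :=
  (memLp_two_iff_integrable_sq hf.aestronglyMeasurable).2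
    (((hf.pow 2).integrableOn_Icc (a := a) (b := b)).mono_set Ioo_subset_Icc_self)

theorem eLpNorm_two_sq {α E : Type*} [MeasurableSpace α] [NormedAddCommGroup E] (f : α → E)
    (μ : Measure α) : eLpNorm f 2 μ ^ 2 = ∫⁻ x, ‖f x‖ₑ ^ 2 ∂μ := by
  rw [eLpNorm_eq_lintegral_rpow_enorm_toReal two_ne_zero ENNReal.ofNat_ne_top,
    ← ENNReal.rpow_natCast, ← ENNReal.rpow_mul]
  simp

theorem eLpNorm_sq_eq {f : ℝ → ℝ} (hf : Continuous f) {a b : ℝ} (hab : a ≤ b) :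
    eLpNorm f 2 (volume.restrict (Ioo a b)) ^ 2 = ENNReal.ofReal (∫ t in a..b, f t ^ 2) := by
  have hi : IntegrableOn (fun t => f t ^ 2) (Ioo a b) :=
    ((hf.pow 2).integrableOn_Icc (a := a) (b := b)).mono_set Ioo_subset_Icc_self
  rw [eLpNorm_two_sq, intervalIntegral.integral_of_le hab, integral_Ioc_eq_integral_Ioo,
    ofReal_integral_eq_lintegral_ofReal hi (ae_of_all _ fun x => sq_nonneg _)]
  congr 1; ext x
  rw [← ofReal_norm, ← ENNReal.ofReal_pow (norm_nonneg _), Real.norm_eq_abs, sq_abs]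

theorem gagliardoSq_const_smul (a b σ c : ℝ) (f : ℝ → ℝ) :
    gagliardoSq a b σ (c • f) = ‖c‖ₑ ^ 2 * gagliardoSq a b σ f := by
  unfold gagliardoSq
  rw [← lintegral_const_mul' _ _ (by simp)]
  congr 1; ext x
  rw [← lintegral_const_mul' _ _ (by simp)]
  congr 1; ext z
  simp only [Pi.smul_apply, ← smul_sub, enorm_smul, mul_pow]
  rw [mul_div_assoc]

/-- Multiplying a derivative chain of f by c gives one of c f. This direction is all that
normalizing a multiplier requires. -/
theorem sobolevENorm_const_smul_le (a b s : ℝ) {c : ℝ} (hc : c ≠ 0) (f : ℝ → ℝ) :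
    sobolevENorm a b s (c • f) ≤ ‖c‖ₑ * sobolevENorm a b s f := by
  unfold sobolevENorm
  rw [ENNReal.mul_iInf_of_ne (by simpa using hc) (by simp)]
  refine le_iInf fun D => ?_
  rw [ENNReal.mul_iInf_of_ne (by simpa using hc) (by simp)]
  refine le_iInf fun hD => ?_
  refine (iInf₂_le (fun j => c • D j) ⟨⟨fun j hj => (hD.1.memLp j hj).const_smul c,
    fun j hj => (hD.1.weakDeriv j hj).const_smul c⟩, by simp only [hD.2]⟩).trans (le_of_eq ?_)
  have e : ‖c‖ₑ = (‖c‖ₑ ^ 2) ^ (1 / 2 : ℝ) := by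
    rw [← ENNReal.rpow_natCast, ← ENNReal.rpow_mul]; norm_num
  conv_rhs => rw [e]
  rw [← ENNReal.mul_rpow_of_nonneg _ _ (by norm_num)]
  congr 1
  simp only [eLpNorm_const_smul, mul_pow, gagliardoSq_const_smul]
  rw [mul_add, Finset.mul_sum, mul_ite, mul_zero]

theorem rpow_half_sq (x : ℝ≥0∞) : (x ^ (1 / 2 : ℝ)) ^ 2 = x := by
  rw [← ENNReal.rpow_natCast, ← ENNReal.rpow_mul]; norm_num

/-- The norm is an infimum over chains, so exhibiting one chain bounds it; uniqueness of weak
derivatives plays no role. -/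
theorem sobolevENorm_sq_le_of_lt_one {T σ : ℝ} (hT : 0 ≤ T) (h0 : 0 < σ) (h1 : σ < 1)
    {φ : ℝ → ℝ} (hφ : Continuous φ) :
    sobolevENorm 0 T σ φ ^ 2
      ≤ ENNReal.ofReal (∫ t in 0..T, φ t ^ 2) + gagliardoSq 0 T σ φ := by
  have hfl : ⌊σ⌋₊ = 0 := Nat.floor_eq_zero.2 h1
  have := iInf₂_le (f := fun (D : ℕ → ℝ → ℝ) (_ : IsWeakDerivChain 0 T σ D ∧ D 0 = φ) =>
    ((∑ j ∈ Finset.range (⌊σ⌋₊ + 1), eLpNorm (D j) 2 (volume.restrict (Ioo 0 T)) ^ 2) +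
      (if σ - ⌊σ⌋₊ = 0 then 0 else gagliardoSq 0 T (σ - ⌊σ⌋₊) (D ⌊σ⌋₊))) ^ (1 / 2 : ℝ))
    (fun _ => φ) ⟨⟨fun _ _ => memLp_Ioo_of_continuous hφ 0 T, fun j hj => by omega⟩, rfl⟩
  refine (pow_le_pow_left₀ zero_le this 2).trans (le_of_eq ?_)
  rw [rpow_half_sq, hfl]
  simp [h0.ne', eLpNorm_sq_eq hφ hT]

theorem sobolevENorm_one_add_sq_le {T σ : ℝ} (hT : 0 ≤ T) (h0 : 0 ≤ σ) (h1 : σ < 1)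
    {φ φ' : ℝ → ℝ} (hφ : ∀ t, HasDerivAt φ (φ' t) t) (hφ' : Continuous φ') :
    sobolevENorm 0 T (1 + σ) φ ^ 2
      ≤ ENNReal.ofReal (∫ t in 0..T, φ t ^ 2) + ENNReal.ofReal (∫ t in 0..T, φ' t ^ 2)
        + if σ = 0 then 0 else gagliardoSq 0 T σ φ' := by
  have hφc := continuous_of_forall_hasDerivAt hφ
  have hfl : ⌊1 + σ⌋₊ = 1 := (Nat.floor_eq_iff (by linarith)).2 ⟨by simpa, by norm_num; linarith⟩
  have := iInf₂_le (f := fun (D : ℕ → ℝ → ℝ) (_ : IsWeakDerivChain 0 T (1 + σ) D ∧ D 0 = φ) =>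
    ((∑ j ∈ Finset.range (⌊1 + σ⌋₊ + 1), eLpNorm (D j) 2 (volume.restrict (Ioo 0 T)) ^ 2) +
      (if 1 + σ - ⌊1 + σ⌋₊ = 0 then 0
        else gagliardoSq 0 T (1 + σ - ⌊1 + σ⌋₊) (D ⌊1 + σ⌋₊))) ^ (1 / 2 : ℝ))
    (fun j => if j = 0 then φ else φ') ⟨⟨fun j _ => by
        split_ifs
        exacts [memLp_Ioo_of_continuous hφc 0 T, memLp_Ioo_of_continuous hφ' 0 T],
      fun j hj => by
        obtain rfl : j = 0 := by omega
        simpa using hasWeakDeriv_of_hasDerivAt hT hφ hφ'⟩, rfl⟩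
  refine (pow_le_pow_left₀ zero_le this 2).trans (le_of_eq ?_)
  rw [rpow_half_sq, hfl]
  simp [Finset.sum_range_succ, eLpNorm_sq_eq hφc hT, eLpNorm_sq_eq hφ' hT]

/-- A multiplier `φ` with `∫ u φ = S` and `‖φ‖² ≤ K S` bounds `S` by the dual norm of `u`. -/
theorem ofReal_le_dualENorm_sq {T s K S : ℝ} (hK : 0 < K) {u φ : ℝ → ℝ}
    (hφ : sobolevENorm 0 T s φ ^ 2 ≤ ENNReal.ofReal (K * S))
    (hu : ∫ t in Ioo 0 T, u t * φ t = S) :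
    ENNReal.ofReal S ≤ ENNReal.ofReal K * dualENorm T s u ^ 2 := by
  rcases le_or_gt S 0 with hS | hS
  · simp [ENNReal.ofReal_of_nonpos hS]
  -- M = √(K S) bounds the norm of φ, so φ / M is admissible in the supremum and pairs with u to S /
  -- M; finally K (S / M)² = S.
  have hM : 0 < √(K * S) := Real.sqrt_pos.2 (by positivity)
  have hM2 : √(K * S) ^ 2 = K * S := Real.sq_sqrt (by positivity)
  set M := √(K * S)
  have h1 : sobolevENorm 0 T s φ ≤ ENNReal.ofReal M := by
    rw [← hM2, ENNReal.ofReal_pow hM.le] at hφ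
    exact (ENNReal.pow_le_pow_left_iff two_ne_zero).1 hφ
  have h2 : sobolevENorm 0 T s (M⁻¹ • φ) ≤ 1 := by
    refine (sobolevENorm_const_smul_le 0 T s (inv_ne_zero hM.ne') φ).trans ?_
    rw [Real.enorm_of_nonneg (by positivity)]
    calc _ ≤ ENNReal.ofReal M⁻¹ * ENNReal.ofReal M := by gcongr
      _ = 1 := by rw [← ENNReal.ofReal_mul (by positivity), inv_mul_cancel₀ hM.ne']; simp
  have h3 : ENNReal.ofReal (S / M) ≤ dualENorm T s u := by
    refine le_trans (le_of_eq ?_) (le_iSup₂ (f := fun (φ : ℝ → ℝ)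
      (_ : sobolevENorm 0 T s φ ≤ 1) => ‖∫ t in Ioo 0 T, u t * φ t‖ₑ) (M⁻¹ • φ) h2)
    have : ∫ t in Ioo 0 T, u t * (M⁻¹ • φ) t = S / M := by
      rw [← hu, div_eq_inv_mul, ← integral_const_mul]
      congr 1; ext t; simp; ring
    rw [this, Real.enorm_of_nonneg (by positivity)]
  calc ENNReal.ofReal S = ENNReal.ofReal K * ENNReal.ofReal (S / M) ^ 2 := by
        rw [← ENNReal.ofReal_pow (by positivity), ← ENNReal.ofReal_mul hK.le, div_pow, hM2]
        congr 1; field_simp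
    _ ≤ _ := by gcongr

/-! ### Pairing forward and backward problems. -/

/-- Integration by parts for u merely integrable: its primitive is absolutely continuous, with
derivative u almost everywhere. The boundary terms vanish because the primitive is 0 at 0 and G is 0
at T. -/
theorem integral_mul_eq_neg_integral_primitive_mul {T : ℝ} {u G G' : ℝ → ℝ}
    (hu : IntervalIntegrable u volume 0 T) (hG : ∀ t, HasDerivAt G (G' t) t)
    (hG' : Continuous G') (hGT : G T = 0) :
    ∫ t in 0..T, u t * G t = -∫ t in 0..T, (∫ s in 0..t, u s) * G' t := by
  have hd : deriv G = G' := funext fun t => (hG t).deriv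
  have hGc : ContDiff ℝ 1 G :=
    contDiff_one_iff_deriv.2 ⟨fun t => (hG t).differentiableAt, by rwa [hd]⟩
  have h := AbsolutelyContinuousOnInterval.integral_mul_deriv_eq_deriv_mul
    (hGc.contDiffOn.absolutelyContinuousOnInterval (a := 0) (b := T))
    (hu.absolutelyContinuousOnInterval_intervalIntegral (c := 0) left_mem_uIcc)
  have e1 : ∫ t in 0..T, G t * deriv (fun x => ∫ v in 0..x, u v) t = ∫ t in 0..T, u t * G t := by
    apply intervalIntegral.integral_congr_ae
    filter_upwards [hu.ae_hasDerivAt_integral] with t ht htI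
    rw [(ht (uIoc_subset_uIcc htI) 0 left_mem_uIcc).deriv, mul_comm]
  rw [e1, hd, hGT, intervalIntegral.integral_same] at h
  simpa [mul_comm] using h

/-- `Y' = -μ Y + c u`, `Y(0) = 0` on `[0, T]`, in integrated form. -/
structure IsForward (μ T c : ℝ) (u Y : ℝ → ℝ) : Prop where
  int : IntervalIntegrable u volume 0 T
  cont : Continuous Y
  eqn : ∀ t ∈ Icc 0 T, Y t + μ * ∫ s in 0..t, Y s = c * ∫ s in 0..t, u s

namespace IsForward

variable {μ T c : ℝ} {u Y f E : ℝ → ℝ}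

theorem integral_primitive_mul (hY : Continuous Y) (h : IsBackward μ T f E) :
    ∫ t in 0..T, (Y t * E t + (∫ s in 0..t, Y s) * (μ * E t - f t)) = 0 := by
  have hP := hasDerivAt_primitive hY 0
  have hPc := continuous_of_forall_hasDerivAt hP
  have h1 := h.continuous
  have h2 := h.continuous_deriv
  rw [intervalIntegral.integral_eq_sub_of_hasDerivAt (f := fun t => (∫ s in 0..t, Y s) * E t)
    (fun t _ => (hP t).mul (h.deriv t)) (Continuous.intervalIntegrable (by fun_prop) _ _)]
  simp [h.final]

/-- Formally, ∫ c u E = ∫ (Y' + μ Y) E = ∫ Y (μ E - E') = ∫ Y f. As the forward equation is known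
only in integrated form, u is first integrated by parts and c ∫ u is then replaced by Y + μ ∫ Y. -/
theorem integral_mul_backward (H : IsForward μ T c u Y) (hT : 0 ≤ T) (h : IsBackward μ T f E) :
    ∫ t in 0..T, u t * (c * E t) = ∫ t in 0..T, Y t * f t := by
  have hY := H.cont
  have hf := h.cont
  have hE := h.continuous
  have hE' := h.continuous_deriv
  have hPc := continuous_of_forall_hasDerivAt (hasDerivAt_primitive hY 0)
  have e0 := integral_primitive_mul hY h
  have e1 := integral_mul_eq_neg_integral_primitive_mul H.int (h.const_mul c).deriv
    (h.const_mul c).continuous_deriv (h.const_mul c).final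
  have e2 : ∫ t in 0..T, (∫ s in 0..t, u s) * (μ * (c * E t) - c * f t)
      = ∫ t in 0..T, (μ * (Y t * E t + (∫ s in 0..t, Y s) * (μ * E t - f t)) - Y t * f t) := by
    refine intervalIntegral.integral_congr fun t ht => ?_
    rw [uIcc_of_le hT] at ht
    have := H.eqn t ht
    linear_combination (-(μ * E t - f t)) * this
  rw [e1, e2, intervalIntegral.integral_sub, intervalIntegral.integral_const_mul, e0]
  · simp
  · exact Continuous.intervalIntegrable (by fun_prop) _ _
  · exact Continuous.intervalIntegrable (by fun_prop) _ _

/-- Adding the primitive of f cancels f in the derivative of E, leaving μ E. The multiplier gains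
regularity, and f is paired with -μ ∫ Y, which is Y - c U by the forward equation. -/
theorem integral_mul_backward_add_primitive (H : IsForward μ T c u Y) (hT : 0 ≤ T)
    (h : IsBackward μ T f E) :
    ∫ t in 0..T, u t * (c * (E t + ∫ s in T..t, f s))
      = ∫ t in 0..T, (-(μ * ∫ s in 0..t, Y s)) * f t := by
  have hY := H.cont
  have hf := h.cont
  have hE := h.continuous
  have hE' := h.continuous_deriv
  have hPc := continuous_of_forall_hasDerivAt (hasDerivAt_primitive hY 0)
  have e0 := integral_primitive_mul hY h
  have e1 := integral_mul_eq_neg_integral_primitive_mul H.int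
    (G := fun t => c * (E t + ∫ s in T..t, f s)) (G' := fun t => c * (μ * E t))
    (fun t => (((h.deriv t).add (hasDerivAt_primitive hf T t)).const_mul c).congr_deriv (by ring))
    (by fun_prop) (by simp [h.final])
  have e2 : ∫ t in 0..T, (∫ s in 0..t, u s) * (c * (μ * E t))
      = ∫ t in 0..T, (μ * (Y t * E t + (∫ s in 0..t, Y s) * (μ * E t - f t))
        - (-(μ * ∫ s in 0..t, Y s)) * f t) := by
    refine intervalIntegral.integral_congr fun t ht => ?_
    rw [uIcc_of_le hT] at ht
    have := H.eqn t ht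
    linear_combination (-(μ * E t)) * this
  rw [e1, e2, intervalIntegral.integral_sub, intervalIntegral.integral_const_mul, e0]
  · simp
  · exact Continuous.intervalIntegrable (by fun_prop) _ _
  · exact Continuous.intervalIntegrable (by fun_prop) _ _

end IsForward

/-! ### The three multiplier estimates. -/

theorem sum_inv_sq_le_two (N : ℕ) :
    ∑ n ∈ Finset.range N, (((n + 1 : ℕ) : ℝ) ^ 2)⁻¹ ≤ 2 := by
  suffices ∑ n ∈ Finset.range N, (((n + 1 : ℕ) : ℝ) ^ 2)⁻¹ ≤ 2 - (N : ℝ)⁻¹ from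
    this.trans (by simp)
  induction N with
  | zero => simp
  | succ N ih =>
    rw [Finset.sum_range_succ]
    rcases N.eq_zero_or_pos with rfl | hN
    · norm_num
    have hN' : (0 : ℝ) < N := by exact_mod_cast hN
    have : (((N + 1 : ℕ) : ℝ) ^ 2)⁻¹ ≤ (N : ℝ)⁻¹ - ((N + 1 : ℕ) : ℝ)⁻¹ := by
      push_cast
      rw [inv_sub_inv (by positivity) (by positivity), inv_eq_one_div,
        div_le_div_iff₀ (by positivity) (by positivity)]
      nlinarith
    linarith

/-- Cauchy–Schwarz with weights (n+1)^(-2). In the applications the loss (n+1)² is absorbed by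
(n+1)² c_n² ≤ 8. -/
theorem integral_sq_sum_le {T : ℝ} (hT : 0 ≤ T) {N : ℕ} {g : ℕ → ℝ → ℝ}
    (hg : ∀ n, Continuous (g n)) :
    ∫ t in 0..T, (∑ n ∈ Finset.range N, g n t) ^ 2
      ≤ 2 * ∑ n ∈ Finset.range N, ((n + 1 : ℕ) : ℝ) ^ 2 * ∫ t in 0..T, g n t ^ 2 := by
  have h1 : ∫ t in 0..T, (∑ n ∈ Finset.range N, g n t) ^ 2
      ≤ ∫ t in 0..T, 2 * ∑ n ∈ Finset.range N, ((n + 1 : ℕ) : ℝ) ^ 2 * g n t ^ 2 := by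
    apply intervalIntegral.integral_mono_on hT
    · exact Continuous.intervalIntegrable (by fun_prop) _ _
    · exact Continuous.intervalIntegrable (by fun_prop) _ _
    · intro t _
      have := sq_sum_le_sum_sq_div (p := fun n : ℕ => (((n + 1 : ℕ) : ℝ) ^ 2)⁻¹)
        (fun n => by positivity) (sum_inv_sq_le_two N) fun n => g n t
      simpa only [div_inv_eq_mul, mul_comm] using this
  rw [intervalIntegral.integral_const_mul, intervalIntegral.integral_finsetSum fun n _ =>
    Continuous.intervalIntegrable (by fun_prop) _ _] at h1
  simpa only [intervalIntegral.integral_const_mul] using h1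

theorem integral_Ioo_mul_sum {T : ℝ} (hT : 0 ≤ T) {u : ℝ → ℝ}
    (hu : IntervalIntegrable u volume 0 T) {N : ℕ} {g : ℕ → ℝ → ℝ} (hg : ∀ n, Continuous (g n)) :
    ∫ t in Ioo 0 T, u t * ∑ n ∈ Finset.range N, g n t
      = ∑ n ∈ Finset.range N, ∫ t in 0..T, u t * g n t := by
  rw [← integral_Ioc_eq_integral_Ioo, ← intervalIntegral.integral_of_le hT]
  simp only [Finset.mul_sum]
  exact intervalIntegral.integral_finsetSum fun n _ => hu.mul_continuousOn (hg n).continuousOn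

/-- The Dirichlet eigenvalues of `-d²/dx²` on `(0, 1)`. -/
def eigenvalue (n : ℕ) : ℝ := (((n + 1 : ℕ) : ℝ) * Real.pi) ^ 2

theorem sq_le_eigenvalue (n : ℕ) : ((n + 1 : ℕ) : ℝ) ^ 2 ≤ eigenvalue n := by
  unfold eigenvalue
  have : (1 : ℝ) ≤ Real.pi := by linarith [Real.pi_gt_three]
  exact pow_le_pow_left₀ (by positivity) (le_mul_of_one_le_right (by positivity) this) 2

theorem eigenvalue_le (n : ℕ) : eigenvalue n ≤ 10 * ((n + 1 : ℕ) : ℝ) ^ 2 := by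
  unfold eigenvalue
  have : Real.pi ^ 2 ≤ 10 := by nlinarith [Real.pi_lt_d2, Real.pi_gt_three]
  rw [mul_pow, mul_comm]
  gcongr

theorem one_le_eigenvalue (n : ℕ) : 1 ≤ eigenvalue n :=
  le_trans (one_le_pow₀ (by simp)) (sq_le_eigenvalue n)

section Multipliers

variable {T : ℝ} {u : ℝ → ℝ} {c : ℕ → ℝ} {Y : ℕ → ℝ → ℝ}

/-- The multiplier is Σ c_n E_n with data Y_n. The L² norms of φ and φ' contribute 2 · 8 each, which
makes 32. -/
theorem sum_integral_sq_le_dualENorm_one (hT : 0 < T) (hc : ∀ n, c n ^ 2 * eigenvalue n ≤ 8)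
    (hu : IntervalIntegrable u volume 0 T) (H : ∀ n, IsForward (eigenvalue n) T (c n) u (Y n))
    (N : ℕ) :
    ENNReal.ofReal (∑ n ∈ Finset.range N, ∫ t in 0..T, Y n t ^ 2)
      ≤ ENNReal.ofReal 32 * dualENorm T 1 u ^ 2 := by
  have B : ∀ n, IsBackward (eigenvalue n) T (Y n) (backward (eigenvalue n) T (Y n)) :=
    fun n => isBackward_backward _ T (H n).cont
  set E : ℕ → ℝ → ℝ := fun n => backward (eigenvalue n) T (Y n)
  have hμ : ∀ n, 0 < eigenvalue n := fun n => zero_lt_one.trans_le (one_le_eigenvalue n)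
  have hA : ∀ n, 0 ≤ ∫ t in 0..T, Y n t ^ 2 := fun n =>
    intervalIntegral.integral_nonneg hT.le fun t _ => sq_nonneg _
  have hB : ∀ n, 0 ≤ ∫ t in 0..T, E n t ^ 2 := fun n =>
    intervalIntegral.integral_nonneg hT.le fun t _ => sq_nonneg _
  have hck : ∀ n, ((n + 1 : ℕ) : ℝ) ^ 2 * c n ^ 2 ≤ 8 := fun n => by
    nlinarith [hc n, mul_le_mul_of_nonneg_left (sq_le_eigenvalue n) (sq_nonneg (c n))]
  refine ofReal_le_dualENorm_sq (φ := fun t => ∑ n ∈ Finset.range N, c n * E n t) (by norm_num)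
    ?_ ?_
  · have h1 := sobolevENorm_one_add_sq_le (T := T) hT.le le_rfl zero_lt_one
      (φ := fun t => ∑ n ∈ Finset.range N, c n * E n t)
      (φ' := fun t => ∑ n ∈ Finset.range N, c n * (eigenvalue n * E n t - Y n t))
      (fun t => HasDerivAt.fun_sum fun n _ => ((B n).deriv t).const_mul (c n))
      (by have := fun n => (B n).continuous_deriv; fun_prop)
    rw [add_zero, if_pos rfl, add_zero] at h1
    refine h1.trans ?_
    rw [← ENNReal.ofReal_add (intervalIntegral.integral_nonneg hT.le fun t _ => sq_nonneg _)
      (intervalIntegral.integral_nonneg hT.le fun t _ => sq_nonneg _)]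
    apply ENNReal.ofReal_le_ofReal
    have h2 := integral_sq_sum_le hT.le (N := N) (g := fun n t => c n * E n t)
      fun n => (B n).continuous.const_mul _
    have h3 := integral_sq_sum_le hT.le (N := N)
      (g := fun n t => c n * (eigenvalue n * E n t - Y n t))
      fun n => (B n).continuous_deriv.const_mul _
    simp only [mul_pow, intervalIntegral.integral_const_mul] at h2 h3
    have h4 : ∑ n ∈ Finset.range N, ((n + 1 : ℕ) : ℝ) ^ 2 * (c n ^ 2 * ∫ t in 0..T, E n t ^ 2)
        ≤ ∑ n ∈ Finset.range N, 8 * ∫ t in 0..T, Y n t ^ 2 := by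
      refine Finset.sum_le_sum fun n _ => ?_
      have e1 := (B n).integral_sq_le hT.le (hμ n)
      have e2 : ∫ t in 0..T, E n t ^ 2 ≤ ∫ t in 0..T, Y n t ^ 2 :=
        le_trans (le_mul_of_one_le_left (hB n) (one_le_pow₀ (one_le_eigenvalue n))) e1
      rw [← mul_assoc]
      exact mul_le_mul (hck n) e2 (hB n) (by norm_num)
    have h5 : ∑ n ∈ Finset.range N, ((n + 1 : ℕ) : ℝ) ^ 2 *
          (c n ^ 2 * ∫ t in 0..T, (eigenvalue n * E n t - Y n t) ^ 2)
        ≤ ∑ n ∈ Finset.range N, 8 * ∫ t in 0..T, Y n t ^ 2 := by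
      refine Finset.sum_le_sum fun n _ => ?_
      rw [← mul_assoc]
      exact mul_le_mul (hck n) ((B n).integral_sq_deriv_le hT.le (hμ n))
        (intervalIntegral.integral_nonneg hT.le fun t _ => sq_nonneg _) (by norm_num)
    rw [← Finset.mul_sum] at h4 h5
    linarith
  · rw [integral_Ioo_mul_sum hT.le hu fun n => (B n).continuous.const_mul _]
    refine Finset.sum_congr rfl fun n _ => ?_
    rw [(H n).integral_mul_backward hT.le (B n)]
    simp only [sq]

/-- The constant of the `H^(3/4)` estimate. -/
def energyConst : ℝ := 16 + 16 * gagliardoConst (5 / 2)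

/-- The multiplier is Σ μ_n c_n E_n. At σ = 3/4 the power (n+1)^(4σ-3) in the seminorm bound is 1,
and the data satisfy (μ_n c_n Y_n)² ≤ 8 μ_n Y_n², exactly the quantity to be bounded. -/
theorem sum_eigenvalue_mul_integral_sq_le_dualENorm (hT : 0 < T)
    (hc : ∀ n, c n ^ 2 * eigenvalue n ≤ 8)
    (hu : IntervalIntegrable u volume 0 T) (H : ∀ n, IsForward (eigenvalue n) T (c n) u (Y n))
    (N : ℕ) :
    ENNReal.ofReal (∑ n ∈ Finset.range N, eigenvalue n * ∫ t in 0..T, Y n t ^ 2)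
      ≤ ENNReal.ofReal energyConst * dualENorm T (3 / 4) u ^ 2 := by
  have B' : ∀ n, IsBackward (eigenvalue n) T (Y n) (backward (eigenvalue n) T (Y n)) :=
    fun n => isBackward_backward _ T (H n).cont
  set E : ℕ → ℝ → ℝ := fun n => backward (eigenvalue n) T (Y n)
  have B : ∀ n, IsBackward (eigenvalue n) T (fun t => eigenvalue n * c n * Y n t)
      (fun t => eigenvalue n * c n * E n t) := fun n => (B' n).const_mul _
  have hEc : ∀ n, Continuous (E n) := fun n => (B' n).continuous
  have hμ : ∀ n, 0 < eigenvalue n := fun n => zero_lt_one.trans_le (one_le_eigenvalue n)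
  have hA : ∀ n, 0 ≤ ∫ t in 0..T, Y n t ^ 2 := fun n =>
    intervalIntegral.integral_nonneg hT.le fun t _ => sq_nonneg _
  have hck : ∀ n, ((n + 1 : ℕ) : ℝ) ^ 2 * c n ^ 2 ≤ 8 := fun n => by
    nlinarith [hc n, mul_le_mul_of_nonneg_left (sq_le_eigenvalue n) (sq_nonneg (c n))]
  have hG : 0 < gagliardoConst (5 / 2) := gagliardoConst_pos (by norm_num) (by norm_num)
  refine ofReal_le_dualENorm_sq
    (φ := fun t => ∑ n ∈ Finset.range N, eigenvalue n * c n * E n t) (by unfold energyConst; positivity)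
    ?_ ?_
  · have h1 := sobolevENorm_sq_le_of_lt_one (T := T) (σ := 3 / 4) hT.le (by norm_num) (by norm_num)
      (φ := fun t => ∑ n ∈ Finset.range N, eigenvalue n * c n * E n t) (by fun_prop)
    have h2 := gagliardoSq_sum_backward_le (σ := 3 / 4) (N := N) hT (by norm_num) (by norm_num)
      sq_le_eigenvalue B
    refine (h1.trans (add_le_add_right h2 _)).trans ?_
    rw [← ENNReal.ofReal_add (intervalIntegral.integral_nonneg hT.le fun t _ => sq_nonneg _)]
    swap
    · rw [show (1 : ℝ) + 2 * (3 / 4) = 5 / 2 by norm_num]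
      refine mul_nonneg (by positivity) (Finset.sum_nonneg fun n _ => mul_nonneg (by positivity)
        (intervalIntegral.integral_nonneg hT.le fun t _ => sq_nonneg _))
    apply ENNReal.ofReal_le_ofReal
    have h3 := integral_sq_sum_le hT.le (N := N) (g := fun n t => eigenvalue n * c n * E n t)
      fun n => by fun_prop
    norm_num only [mul_pow, intervalIntegral.integral_const_mul, Real.rpow_zero, one_mul] at h3 ⊢
    have h4 : ∑ n ∈ Finset.range N, ((n + 1 : ℕ) : ℝ) ^ 2 *
          (eigenvalue n ^ 2 * c n ^ 2 * ∫ t in 0..T, E n t ^ 2)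
        ≤ ∑ n ∈ Finset.range N, 8 * (eigenvalue n * ∫ t in 0..T, Y n t ^ 2) := by
      refine Finset.sum_le_sum fun n _ => ?_
      have e1 := (B' n).integral_sq_le hT.le (hμ n)
      calc _ = (((n + 1 : ℕ) : ℝ) ^ 2 * c n ^ 2) *
            (eigenvalue n ^ 2 * ∫ t in 0..T, E n t ^ 2) := by ring
        _ ≤ 8 * ∫ t in 0..T, Y n t ^ 2 := mul_le_mul (hck n) e1
            (mul_nonneg (sq_nonneg _)
              (intervalIntegral.integral_nonneg hT.le fun t _ => sq_nonneg _)) (by norm_num)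
        _ ≤ _ := by
            gcongr
            exact le_mul_of_one_le_left (hA n) (one_le_eigenvalue n)
    have h5 : ∑ n ∈ Finset.range N, eigenvalue n ^ 2 * c n ^ 2 * ∫ t in 0..T, Y n t ^ 2
        ≤ ∑ n ∈ Finset.range N, 8 * (eigenvalue n * ∫ t in 0..T, Y n t ^ 2) := by
      refine Finset.sum_le_sum fun n _ => ?_
      calc _ = (c n ^ 2 * eigenvalue n) * (eigenvalue n * ∫ t in 0..T, Y n t ^ 2) := by ring
        _ ≤ _ := mul_le_mul_of_nonneg_right (hc n) (mul_nonneg (hμ n).le (hA n))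
    rw [← Finset.mul_sum] at h4 h5
    unfold energyConst
    nlinarith [mul_le_mul_of_nonneg_left h5 hG.le]
  · rw [integral_Ioo_mul_sum hT.le hu fun n => (B n).continuous]
    refine Finset.sum_congr rfl fun n _ => ?_
    have e := (H n).integral_mul_backward hT.le (B' n)
    calc _ = ∫ t in 0..T, eigenvalue n * (u t * (c n * E n t)) := by
          congr 1; ext t; ring
      _ = _ := by
          rw [intervalIntegral.integral_const_mul, e]
          simp only [sq]

/-- The constant of the `H^(5/4)` estimate. -/
def correctorConst (T : ℝ) : ℝ := 64 * T ^ 2 + 16 + 160 * gagliardoConst (3 / 2)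

/-- The multiplier is Σ c_n J_n, with derivative Σ c_n μ_n E_n. At σ = 1/4 the seminorm bound
carries (n+1)^(-2), and (n+1)^(-2) c_n² μ_n² ≤ 80. In the constant, 64 T² comes from the Poincaré
inequality for J_n, 16 from φ' in L², and 160 = 2 · 80 from the seminorm. -/
theorem sum_integral_sq_sub_le_dualENorm (hT : 0 < T) (hc : ∀ n, c n ^ 2 * eigenvalue n ≤ 8)
    (hu : IntervalIntegrable u volume 0 T) (H : ∀ n, IsForward (eigenvalue n) T (c n) u (Y n))
    (N : ℕ) :
    ENNReal.ofReal (∑ n ∈ Finset.range N, ∫ t in 0..T, (Y n t - c n * ∫ s in 0..t, u s) ^ 2)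
      ≤ ENNReal.ofReal (correctorConst T) * dualENorm T (5 / 4) u ^ 2 := by
  -- On [0, T] this is Y_n - c_n U; in this form it is continuous on the whole line, as data of a
  -- backward problem must be.
  set W : ℕ → ℝ → ℝ := fun n t => -(eigenvalue n * ∫ s in 0..t, Y n s) with hW
  have hWc : ∀ n, Continuous (W n) := fun n =>
    ((continuous_of_forall_hasDerivAt (hasDerivAt_primitive (H n).cont 0)).const_mul _).neg
  have hWe : ∀ n, ∫ t in 0..T, (Y n t - c n * ∫ s in 0..t, u s) ^ 2 = ∫ t in 0..T, W n t ^ 2 := by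
    refine fun n => intervalIntegral.integral_congr fun t ht => ?_
    rw [uIcc_of_le hT.le] at ht
    have := (H n).eqn t ht
    simp only [hW]
    congr 1
    linarith
  simp only [hWe]
  have B : ∀ n, IsBackward (eigenvalue n) T (W n) (backward (eigenvalue n) T (W n)) :=
    fun n => isBackward_backward _ T (hWc n)
  set E : ℕ → ℝ → ℝ := fun n => backward (eigenvalue n) T (W n)
  have hEc : ∀ n, Continuous (E n) := fun n => (B n).continuous
  set J : ℕ → ℝ → ℝ := fun n t => E n t + ∫ s in T..t, W n s
  have hJ : ∀ n t, HasDerivAt (J n) (eigenvalue n * E n t) t := fun n t =>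
    (((B n).deriv t).add (hasDerivAt_primitive (hWc n) T t)).congr_deriv (by ring)
  have hJc : ∀ n, Continuous (J n) := fun n => continuous_of_forall_hasDerivAt (hJ n)
  have hμ : ∀ n, 0 < eigenvalue n := fun n => zero_lt_one.trans_le (one_le_eigenvalue n)
  have hA : ∀ n, 0 ≤ ∫ t in 0..T, W n t ^ 2 := fun n =>
    intervalIntegral.integral_nonneg hT.le fun t _ => sq_nonneg _
  have hE : ∀ n, eigenvalue n ^ 2 * ∫ t in 0..T, E n t ^ 2 ≤ ∫ t in 0..T, W n t ^ 2 := fun n =>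
    (B n).integral_sq_le hT.le (hμ n)
  have hck : ∀ n, ((n + 1 : ℕ) : ℝ) ^ 2 * c n ^ 2 ≤ 8 := fun n => by
    nlinarith [hc n, mul_le_mul_of_nonneg_left (sq_le_eigenvalue n) (sq_nonneg (c n))]
  have hG : 0 < gagliardoConst (3 / 2) := gagliardoConst_pos (by norm_num) (by norm_num)
  have hEnn : ∀ n, 0 ≤ ∫ t in 0..T, E n t ^ 2 := fun n =>
    intervalIntegral.integral_nonneg hT.le fun t _ => sq_nonneg _
  refine ofReal_le_dualENorm_sq (φ := fun t => ∑ n ∈ Finset.range N, c n * J n t)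
    (by unfold correctorConst; positivity) ?_ ?_
  · have h1 := sobolevENorm_one_add_sq_le (T := T) (σ := 1 / 4) hT.le (by norm_num) (by norm_num)
      (φ := fun t => ∑ n ∈ Finset.range N, c n * J n t)
      (φ' := fun t => ∑ n ∈ Finset.range N, c n * eigenvalue n * E n t)
      (fun t => HasDerivAt.fun_sum fun n _ =>
        ((hJ n t).const_mul (c n)).congr_deriv (by ring)) (by fun_prop)
    have h2 := gagliardoSq_sum_backward_le (σ := 1 / 4) (N := N) hT (by norm_num) (by norm_num)
      sq_le_eigenvalue fun n => (B n).const_mul (c n * eigenvalue n)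
    rw [if_neg (by norm_num), show (1 : ℝ) + 1 / 4 = 5 / 4 by norm_num] at h1
    refine (h1.trans (add_le_add_right h2 _)).trans ?_
    rw [show (1 : ℝ) + 2 * (1 / 4) = 3 / 2 by norm_num,
      show (4 : ℝ) * (1 / 4) - 3 = -2 by norm_num]
    rw [← ENNReal.ofReal_add (intervalIntegral.integral_nonneg hT.le fun t _ => sq_nonneg _)
      (intervalIntegral.integral_nonneg hT.le fun t _ => sq_nonneg _),
      ← ENNReal.ofReal_add (add_nonneg
        (intervalIntegral.integral_nonneg hT.le fun t _ => sq_nonneg _)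
        (intervalIntegral.integral_nonneg hT.le fun t _ => sq_nonneg _))
        (mul_nonneg (by positivity) (Finset.sum_nonneg fun n _ => mul_nonneg (by positivity)
          (intervalIntegral.integral_nonneg hT.le fun t _ => sq_nonneg _)))]
    apply ENNReal.ofReal_le_ofReal
    have h3 := integral_sq_sum_le hT.le (N := N) (g := fun n t => c n * J n t)
      fun n => by fun_prop
    have h4 := integral_sq_sum_le hT.le (N := N) (g := fun n t => c n * eigenvalue n * E n t)
      fun n => by fun_prop
    simp only [mul_pow, intervalIntegral.integral_const_mul] at h3 h4 ⊢
    have h5 : ∑ n ∈ Finset.range N, ((n + 1 : ℕ) : ℝ) ^ 2 * (c n ^ 2 * ∫ t in 0..T, J n t ^ 2)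
        ≤ ∑ n ∈ Finset.range N, 32 * T ^ 2 * ∫ t in 0..T, W n t ^ 2 := by
      refine Finset.sum_le_sum fun n _ => ?_
      have e1 := integral_sq_le_of_hasDerivAt hT.le (hJ n) (by fun_prop)
        (by simp [J, show E n T = 0 from (B n).final])
      simp only [mul_pow, intervalIntegral.integral_const_mul] at e1
      calc _ = (((n + 1 : ℕ) : ℝ) ^ 2 * c n ^ 2) * ∫ t in 0..T, J n t ^ 2 := by ring
        _ ≤ 8 * (4 * T ^ 2 * ∫ t in 0..T, W n t ^ 2) := by
            refine mul_le_mul (hck n) (e1.trans ?_)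
              (intervalIntegral.integral_nonneg hT.le fun t _ => sq_nonneg _) (by norm_num)
            exact mul_le_mul_of_nonneg_left (hE n) (by positivity)
        _ = _ := by ring
    have h6 : ∑ n ∈ Finset.range N, ((n + 1 : ℕ) : ℝ) ^ 2 *
          (c n ^ 2 * eigenvalue n ^ 2 * ∫ t in 0..T, E n t ^ 2)
        ≤ ∑ n ∈ Finset.range N, 8 * ∫ t in 0..T, W n t ^ 2 := by
      refine Finset.sum_le_sum fun n _ => ?_
      calc _ = (((n + 1 : ℕ) : ℝ) ^ 2 * c n ^ 2) *
            (eigenvalue n ^ 2 * ∫ t in 0..T, E n t ^ 2) := by ring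
        _ ≤ _ := mul_le_mul (hck n) (hE n) (mul_nonneg (sq_nonneg _) (hEnn n)) (by norm_num)
    have h7 : ∑ n ∈ Finset.range N, ((n + 1 : ℕ) : ℝ) ^ (-2 : ℝ) *
          (c n ^ 2 * eigenvalue n ^ 2 * ∫ t in 0..T, W n t ^ 2)
        ≤ ∑ n ∈ Finset.range N, 80 * ∫ t in 0..T, W n t ^ 2 := by
      refine Finset.sum_le_sum fun n _ => ?_
      have hk : (0 : ℝ) < ((n + 1 : ℕ) : ℝ) := by positivity
      have e1 : ((n + 1 : ℕ) : ℝ) ^ (-2 : ℝ) * eigenvalue n ≤ 10 := by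
        rw [Real.rpow_neg hk.le, Real.rpow_two, inv_mul_le_iff₀ (by positivity), mul_comm]
        exact eigenvalue_le n
      calc _ = (((n + 1 : ℕ) : ℝ) ^ (-2 : ℝ) * eigenvalue n) * (c n ^ 2 * eigenvalue n)
            * ∫ t in 0..T, W n t ^ 2 := by ring
        _ ≤ (10 * 8) * ∫ t in 0..T, W n t ^ 2 := by
            refine mul_le_mul_of_nonneg_right (mul_le_mul e1 (hc n) ?_ (by norm_num)) (hA n)
            exact mul_nonneg (sq_nonneg _) (hμ n).le
        _ = _ := by norm_num
    rw [← Finset.mul_sum] at h5 h6 h7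
    unfold correctorConst
    nlinarith [mul_le_mul_of_nonneg_left h7 hG.le]
  · rw [integral_Ioo_mul_sum hT.le hu fun n => (hJc n).const_mul _]
    refine Finset.sum_congr rfl fun n _ => ?_
    rw [(H n).integral_mul_backward_add_primitive hT.le (B n)]
    simp only [sq, hW]

end Multipliers

/-! ### The Dirichlet sine basis of L²(0, 1). -/

/-- A continuous function as an element of `L²(0, 1)`. -/
def contL2 {f : ℝ → ℝ} (hf : Continuous f) : L2 := (memLp_Ioo_of_continuous hf 0 1).toLp f

theorem coeFn_contL2 {f : ℝ → ℝ} (hf : Continuous f) :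
    (contL2 hf : ℝ → ℝ) =ᵐ[volume.restrict (Ioo 0 1)] f := MemLp.coeFn_toLp _

theorem inner_contL2 (v : L2) {f : ℝ → ℝ} (hf : Continuous f) :
    inner ℝ v (contL2 hf) = ∫ x in Ioo 0 1, f x * v x := by
  rw [L2.inner_def]
  refine integral_congr_ae ?_
  filter_upwards [coeFn_contL2 hf] with x hx
  simp [hx]

theorem inner_contL2_contL2 {f g : ℝ → ℝ} (hf : Continuous f) (hg : Continuous g) :
    inner ℝ (contL2 hf) (contL2 hg) = ∫ x in 0..1, f x * g x := by
  rw [inner_contL2, intervalIntegral.integral_of_le zero_le_one, integral_Ioc_eq_integral_Ioo]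
  refine integral_congr_ae ?_
  filter_upwards [coeFn_contL2 hf] with x hx
  rw [hx, mul_comm]

/-- The square root of the eigenvalue. -/
def freq (n : ℕ) : ℝ := ((n + 1 : ℕ) : ℝ) * Real.pi

theorem freq_pos (n : ℕ) : 0 < freq n := by unfold freq; positivity

theorem freq_sq (n : ℕ) : freq n ^ 2 = eigenvalue n := rfl

theorem continuous_sin_mode (n : ℕ) : Continuous fun x => √2 * Real.sin (freq n * x) := by
  fun_prop

theorem continuous_cos_mode (n : ℕ) : Continuous fun x => √2 * Real.cos (freq n * x) := by
  fun_prop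

/-- The Dirichlet eigenfunctions. -/
def sinMode (n : ℕ) : L2 := contL2 (continuous_sin_mode n)

/-- The normalized derivatives of the Dirichlet eigenfunctions. -/
def cosMode (n : ℕ) : L2 := contL2 (continuous_cos_mode n)

theorem integral_cos_int_mul_pi (m : ℤ) :
    ∫ x in (0 : ℝ)..1, Real.cos (m * Real.pi * x) = if m = 0 then 1 else 0 := by
  split_ifs with h
  · simp [h]
  · have hm : (m : ℝ) * Real.pi ≠ 0 := mul_ne_zero (by exact_mod_cast h) Real.pi_ne_zero
    rw [intervalIntegral.integral_comp_mul_left _ hm]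
    simp [Real.sin_int_mul_pi]

theorem integral_sin_mul_sin (i j : ℕ) :
    ∫ x in (0 : ℝ)..1, (√2 * Real.sin (freq i * x)) * (√2 * Real.sin (freq j * x))
      = if i = j then 1 else 0 := by
  have h2 : √2 * √2 = (2 : ℝ) := Real.mul_self_sqrt (by norm_num)
  have e : ∀ x : ℝ, (√2 * Real.sin (freq i * x)) * (√2 * Real.sin (freq j * x))
      = Real.cos (((i - j : ℤ) : ℝ) * Real.pi * x)
        - Real.cos (((i + j + 2 : ℤ) : ℝ) * Real.pi * x) := fun x => by
    have e1 : ((i - j : ℤ) : ℝ) * Real.pi * x = freq i * x - freq j * x := by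
      unfold freq; push_cast; ring
    have e2 : ((i + j + 2 : ℤ) : ℝ) * Real.pi * x = freq i * x + freq j * x := by
      unfold freq; push_cast; ring
    rw [e1, e2, Real.cos_sub, Real.cos_add]
    linear_combination (Real.sin (freq i * x) * Real.sin (freq j * x)) * h2
  simp only [e]
  rw [intervalIntegral.integral_sub (Continuous.intervalIntegrable (by fun_prop) _ _)
    (Continuous.intervalIntegrable (by fun_prop) _ _), integral_cos_int_mul_pi,
    integral_cos_int_mul_pi, if_neg (by omega : ¬ (i + j + 2 : ℤ) = 0), sub_zero]
  simp only [sub_eq_zero, Nat.cast_inj]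

theorem integral_cos_mul_cos (i j : ℕ) :
    ∫ x in (0 : ℝ)..1, (√2 * Real.cos (freq i * x)) * (√2 * Real.cos (freq j * x))
      = if i = j then 1 else 0 := by
  have h2 : √2 * √2 = (2 : ℝ) := Real.mul_self_sqrt (by norm_num)
  have e : ∀ x : ℝ, (√2 * Real.cos (freq i * x)) * (√2 * Real.cos (freq j * x))
      = Real.cos (((i - j : ℤ) : ℝ) * Real.pi * x)
        + Real.cos (((i + j + 2 : ℤ) : ℝ) * Real.pi * x) := fun x => by
    have e1 : ((i - j : ℤ) : ℝ) * Real.pi * x = freq i * x - freq j * x := by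
      unfold freq; push_cast; ring
    have e2 : ((i + j + 2 : ℤ) : ℝ) * Real.pi * x = freq i * x + freq j * x := by
      unfold freq; push_cast; ring
    rw [e1, e2, Real.cos_sub, Real.cos_add]
    linear_combination (Real.cos (freq i * x) * Real.cos (freq j * x)) * h2
  simp only [e]
  rw [intervalIntegral.integral_add (Continuous.intervalIntegrable (by fun_prop) _ _)
    (Continuous.intervalIntegrable (by fun_prop) _ _), integral_cos_int_mul_pi,
    integral_cos_int_mul_pi, if_neg (by omega : ¬ (i + j + 2 : ℤ) = 0), add_zero]
  simp only [sub_eq_zero, Nat.cast_inj]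

theorem orthonormal_sinMode : Orthonormal ℝ sinMode := by
  rw [orthonormal_iff_ite]
  intro i j
  exact (inner_contL2_contL2 _ _).trans (integral_sin_mul_sin i j)

theorem orthonormal_cosMode : Orthonormal ℝ cosMode := by
  rw [orthonormal_iff_ite]
  intro i j
  exact (inner_contL2_contL2 _ _).trans (integral_cos_mul_cos i j)

/-- The odd extension of v to (-1, 1) has only sine terms in its Fourier series of period 2, and
these vanish; Parseval on (-1, 1) then gives v = 0. -/
theorem eq_zero_of_inner_sinMode {v : L2} (hv : ∀ n, inner ℝ v (sinMode n) = 0) : v = 0 := by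
  have hs : ∀ m : ℤ, ∫ x in Ioo 0 1, Real.sin (m * Real.pi * x) * v x = 0 := by
    have hnat : ∀ n : ℕ, ∫ x in Ioo 0 1, Real.sin (((n + 1 : ℕ) : ℝ) * Real.pi * x) * v x = 0 := by
      intro n
      have := hv n
      rw [sinMode, inner_contL2] at this
      simp only [mul_assoc (√2)] at this
      rw [integral_const_mul] at this
      exact (mul_eq_zero.1 this).resolve_left (by positivity)
    intro m
    rcases lt_trichotomy m 0 with hm | rfl | hm
    · obtain ⟨n, rfl⟩ : ∃ n : ℕ, m = -((n + 1 : ℕ) : ℤ) := ⟨(-m - 1).toNat, by omega⟩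
      have := hnat n
      simp only [Int.cast_neg, Int.cast_natCast, neg_mul, Real.sin_neg, integral_neg, this,
        neg_zero]
    · simp
    · obtain ⟨n, rfl⟩ : ∃ n : ℕ, m = ((n + 1 : ℕ) : ℤ) := ⟨(m - 1).toNat, by omega⟩
      exact_mod_cast hnat n
  set G : ℝ → ℝ := (Ioo 0 1).indicator v with hG
  have hGm : MemLp G 2 volume := (memLp_indicator_iff_restrict measurableSet_Ioo).2 (Lp.memLp v)
  have hGn : MemLp (fun x => G (-x)) 2 volume :=
    hGm.comp_measurePreserving (Measure.measurePreserving_neg volume)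
  -- The odd extension of v, written with the extension G by zero so that both terms make sense
  -- everywhere.
  set F : ℝ → ℂ := fun x => ((G x - G (-x) : ℝ) : ℂ) with hF
  have hFm : MemLp F 2 (volume.restrict (Ioc (-1) 1)) := ((hGm.sub hGn).ofReal).restrict _
  have hGi : IntervalIntegrable (fun x => (G x : ℂ)) volume (-1) 1 := by
    rw [intervalIntegrable_iff_integrableOn_Ioc_of_le (by norm_num)]
    exact (hGm.ofReal.restrict _).integrable one_le_two
  have hGni : IntervalIntegrable (fun x => (G (-x) : ℂ)) volume (-1) 1 := by
    rw [intervalIntegrable_iff_integrableOn_Ioc_of_le (by norm_num)]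
    exact (hGn.ofReal.restrict _).integrable one_le_two
  have hab : (-1 : ℝ) < 1 := by norm_num
  have hcoef : ∀ n, fourierCoeffOn hab F n = 0 := by
    intro n
    rw [fourierCoeffOn_eq_integral]
    have he : ∀ x : ℝ, fourier (-n) (x : AddCircle ((1 : ℝ) - -1))
        = Complex.exp (-(n * Real.pi * x : ℝ) * Complex.I) := fun x => by
      rw [fourier_coe_apply]; congr 1; push_cast; ring
    have hec : Continuous fun x : ℝ => Complex.exp (-(n * Real.pi * x : ℝ) * Complex.I) := by
      fun_prop
    have hec' : Continuous fun x : ℝ => Complex.exp ((n * Real.pi * x : ℝ) * Complex.I) := by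
      fun_prop
    have h1 : ∫ x in (-1 : ℝ)..1, Complex.exp (-(n * Real.pi * x : ℝ) * Complex.I) * (G (-x) : ℂ)
        = ∫ x in (-1 : ℝ)..1, Complex.exp ((n * Real.pi * x : ℝ) * Complex.I) * (G x : ℂ) := by
      have := intervalIntegral.integral_comp_neg (a := -1) (b := 1)
        fun x : ℝ => Complex.exp ((n * Real.pi * x : ℝ) * Complex.I) * (G x : ℂ)
      simpa using this
    have h2 : ∫ x in (-1 : ℝ)..1, fourier (-n) (x : AddCircle ((1 : ℝ) - -1)) • F x
        = ∫ x in (-1 : ℝ)..1,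
          (-2 * Complex.I) * ((Real.sin (n * Real.pi * x) * G x : ℝ) : ℂ) := by
      calc _ = ∫ x in (-1 : ℝ)..1,
            (Complex.exp (-(n * Real.pi * x : ℝ) * Complex.I) * (G x : ℂ)
              - Complex.exp (-(n * Real.pi * x : ℝ) * Complex.I) * (G (-x) : ℂ)) := by
            refine intervalIntegral.integral_congr fun x _ => ?_
            simp only [he, hF, smul_eq_mul]; push_cast; ring
        _ = ∫ x in (-1 : ℝ)..1,
            (Complex.exp (-(n * Real.pi * x : ℝ) * Complex.I) * (G x : ℂ)
              - Complex.exp ((n * Real.pi * x : ℝ) * Complex.I) * (G x : ℂ)) := by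
            rw [intervalIntegral.integral_sub (hGi.continuousOn_mul hec.continuousOn)
              (hGni.continuousOn_mul hec.continuousOn), h1,
              intervalIntegral.integral_sub (hGi.continuousOn_mul hec.continuousOn)
              (hGi.continuousOn_mul hec'.continuousOn)]
        _ = _ := by
            refine intervalIntegral.integral_congr fun x _ => ?_
            rw [Complex.exp_mul_I, ← Complex.ofReal_neg, Complex.exp_mul_I, Complex.ofReal_neg,
              Complex.cos_neg, Complex.sin_neg]
            push_cast; ring
    rw [h2, intervalIntegral.integral_const_mul, intervalIntegral.integral_ofReal,
      intervalIntegral.integral_of_le (by norm_num)]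
    have h3 : ∫ x in Ioc (-1 : ℝ) 1, Real.sin (n * Real.pi * x) * G x = 0 := by
      have : (fun x => Real.sin (n * Real.pi * x) * G x)
          = (Ioo 0 1).indicator fun x => Real.sin (n * Real.pi * x) * v x := by
        ext x; by_cases hx : x ∈ Ioo (0 : ℝ) 1 <;> simp [hG, hx]
      rw [this, setIntegral_indicator measurableSet_Ioo, inter_eq_self_of_subset_right, hs n]
      exact fun x hx => ⟨by linarith [hx.1], hx.2.le⟩
    rw [h3]; simp
  have hsum := hasSum_sq_fourierCoeffOn hab hFm
  simp only [hcoef, norm_zero, ne_eq, OfNat.ofNat_ne_zero, not_false_eq_true, zero_pow] at hsum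
  have h0 : ∫ x in Ioc (-1 : ℝ) 1, ‖F x‖ ^ 2 = 0 := by
    have := hsum.unique hasSum_zero
    rw [intervalIntegral.integral_of_le (by norm_num)] at this
    simpa using this
  have hae : F =ᵐ[volume.restrict (Ioc (-1) 1)] 0 := by
    have := (integral_eq_zero_iff_of_nonneg (fun x => sq_nonneg ‖F x‖)
      ((memLp_two_iff_integrable_sq_norm hFm.1).1 hFm)).1 h0
    filter_upwards [this] with x hx
    simpa using hx
  rw [Lp.eq_zero_iff_ae_eq_zero]
  have hae' := ae_restrict_of_ae_restrict_of_subset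
    (show Ioo (0 : ℝ) 1 ⊆ Ioc (-1) 1 from fun x hx => ⟨by linarith [hx.1], hx.2.le⟩) hae
  filter_upwards [hae', ae_restrict_mem measurableSet_Ioo] with x hx hxI
  have hnx : -x ∉ Ioo (0 : ℝ) 1 := fun h => by linarith [h.1, hxI.1]
  simpa [hF, hG, hxI, hnx] using hx

/-- The Hilbert basis of `L²(0, 1)` of Dirichlet eigenfunctions. -/
def sinBasis : HilbertBasis ℕ ℝ L2 :=
  HilbertBasis.mkOfOrthogonalEqBot orthonormal_sinMode <| by
    rw [Submodule.eq_bot_iff]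
    intro v hv
    refine eq_zero_of_inner_sinMode fun n => ?_
    rw [real_inner_comm]
    exact (Submodule.mem_orthogonal _ _).1 hv _ (Submodule.subset_span (mem_range_self n))

theorem coe_sinBasis (n : ℕ) : sinBasis n = sinMode n := by
  simp [sinBasis]

theorem hasSum_sinMode (v : L2) : HasSum (fun n => inner ℝ v (sinMode n) • sinMode n) v := by
  have := sinBasis.hasSum_repr v
  simpa only [HilbertBasis.repr_apply_apply, coe_sinBasis, real_inner_comm] using this

theorem enorm_sq_eq_tsum (v : L2) : ‖v‖ₑ ^ 2 = ∑' n, ‖inner ℝ v (sinMode n)‖ₑ ^ 2 := by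
  have h := sinBasis.hasSum_inner_mul_inner v v
  simp only [coe_sinBasis, real_inner_comm v, real_inner_self_eq_norm_sq, ← sq] at h
  have e : ∀ r : ℝ, ‖r‖ₑ ^ 2 = ENNReal.ofReal (r ^ 2) := fun r => by
    rw [← ofReal_norm, ← ENNReal.ofReal_pow (norm_nonneg _), Real.norm_eq_abs, sq_abs]
  simp only [e]
  rw [← ENNReal.ofReal_tsum_of_nonneg (fun n => sq_nonneg _) h.summable, h.tsum_eq, ← ofReal_norm,
    ← ENNReal.ofReal_pow (norm_nonneg _)]

/-! ### Differentiating sine series and the H¹ norm. -/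

theorem locallyIntegrableOn_L2 (v : L2) : LocallyIntegrableOn (v : ℝ → ℝ) (Ioo 0 1) :=
  IntegrableOn.locallyIntegrableOn ((Lp.memLp v).integrable one_le_two)

theorem hasWeakDeriv_sinMode (n : ℕ) :
    HasWeakDeriv 0 1 (sinMode n : ℝ → ℝ) (freq n • cosMode n : L2) := by
  refine (hasWeakDeriv_of_hasDerivAt zero_le_one
    (f := fun x => √2 * Real.sin (freq n * x)) (f' := fun x => freq n * (√2 * Real.cos (freq n * x)))
    (fun x => ?_) (by fun_prop)).congr (coeFn_contL2 (continuous_sin_mode n)).symm ?_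
  · have := (((hasDerivAt_id x).const_mul (freq n)).sin).const_mul √2
    exact this.congr_deriv (by simp; ring)
  · filter_upwards [coeFn_contL2 (continuous_cos_mode n), Lp.coeFn_smul (freq n) (cosMode n)]
      with x h1 h2
    rw [h2, Pi.smul_apply, cosMode, h1, smul_eq_mul]

theorem hasWeakDeriv_cosMode (n : ℕ) :
    HasWeakDeriv 0 1 (freq n • cosMode n : L2) (-eigenvalue n • sinMode n : L2) := by
  refine (hasWeakDeriv_of_hasDerivAt zero_le_one
    (f := fun x => freq n * (√2 * Real.cos (freq n * x)))
    (f' := fun x => -eigenvalue n * (√2 * Real.sin (freq n * x)))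
    (fun x => ?_) (by fun_prop)).congr ?_ ?_
  · have := ((((hasDerivAt_id x).const_mul (freq n)).cos).const_mul √2).const_mul (freq n)
    exact this.congr_deriv (by rw [← freq_sq]; simp; ring)
  · filter_upwards [coeFn_contL2 (continuous_cos_mode n), Lp.coeFn_smul (freq n) (cosMode n)]
      with x h1 h2
    rw [h2, Pi.smul_apply, cosMode, h1, smul_eq_mul]
  · filter_upwards [coeFn_contL2 (continuous_sin_mode n),
      Lp.coeFn_smul (-eigenvalue n) (sinMode n)] with x h1 h2
    rw [h2, Pi.smul_apply, sinMode, h1, smul_eq_mul]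

/-- For fixed η both sides of the defining identity are continuous linear functionals on L²(0, 1),
so the weak derivative is a closed operator and series can be differentiated termwise. -/
theorem HasWeakDeriv.of_hasSum {f g : ℕ → L2} {F G : L2}
    (h : ∀ n, HasWeakDeriv 0 1 (f n : ℝ → ℝ) (g n : ℝ → ℝ)) (hf : HasSum f F) (hg : HasSum g G) :
    HasWeakDeriv 0 1 (F : ℝ → ℝ) (G : ℝ → ℝ) := by
  refine ⟨locallyIntegrableOn_L2 F, locallyIntegrableOn_L2 G, fun η hη hc hs => ?_⟩
  have hη' : Continuous (deriv η) := hη.continuous_deriv (by simp)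
  have h1 := hf.mapL (innerSL ℝ (contL2 hη'))
  have h2 := (hg.mapL (innerSL ℝ (contL2 hη.continuous))).neg
  simp only [innerSL_apply_apply, real_inner_comm, inner_contL2] at h1 h2
  have e : ∀ n, ∫ x in Ioo 0 1, deriv η x * (f n : ℝ → ℝ) x
      = -∫ x in Ioo 0 1, η x * (g n : ℝ → ℝ) x := fun n => (h n).2.2 η hη hc hs
  simp only [e] at h1
  exact h1.unique h2

/-- An orthonormal family embeds ℓ² isometrically; completeness of the cosines is not needed. -/
theorem exists_hasSum_cosMode {a : ℕ → ℝ} (ha : Summable fun n => a n ^ 2) :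
    ∃ g : L2, HasSum (fun n => a n • cosMode n) g ∧ ‖g‖ ^ 2 = ∑' n, a n ^ 2 := by
  have hV := orthonormal_cosMode.orthogonalFamily
  have hm : Memℓp a 2 := by
    rw [memℓp_gen_iff (by norm_num)]
    simpa using ha
  set f : lp (fun _ : ℕ => ℝ) 2 := ⟨a, hm⟩
  refine ⟨hV.linearIsometry f, ?_, ?_⟩
  · simpa using hV.hasSum_linearIsometry f
  · rw [LinearIsometry.norm_map]
    have := lp.norm_rpow_eq_tsum (p := 2) (by norm_num) f
    simpa [f] using this

theorem enorm_sq_eq_ofReal (r : ℝ) : ‖r‖ₑ ^ 2 = ENNReal.ofReal (r ^ 2) := by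
  rw [← ofReal_norm, ← ENNReal.ofReal_pow (norm_nonneg _), Real.norm_eq_abs, sq_abs]

/-- The `H¹` norm of a function is controlled by its coefficients in the Dirichlet basis. -/
theorem sobolevENorm_one_sq_le_tsum (v : L2) :
    sobolevENorm 0 1 1 v ^ 2
      ≤ ∑' n, ENNReal.ofReal (2 * eigenvalue n) * ‖inner ℝ v (sinMode n)‖ₑ ^ 2 := by
  set y : ℕ → ℝ := fun n => inner ℝ v (sinMode n) with hy
  have hμ : ∀ n, 0 ≤ eigenvalue n := fun n => zero_le_one.trans (one_le_eigenvalue n)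
  have hle : ∑' n, ‖y n‖ₑ ^ 2 + ∑' n, ENNReal.ofReal ((freq n * y n) ^ 2)
      ≤ ∑' n, ENNReal.ofReal (2 * eigenvalue n) * ‖y n‖ₑ ^ 2 := by
    rw [← ENNReal.tsum_add]
    refine ENNReal.tsum_le_tsum fun n => ?_
    have := one_le_eigenvalue n
    rw [enorm_sq_eq_ofReal, ← ENNReal.ofReal_add (sq_nonneg _) (sq_nonneg _),
      ← ENNReal.ofReal_mul (by linarith)]
    apply ENNReal.ofReal_le_ofReal
    rw [mul_pow, freq_sq]
    nlinarith [mul_le_mul_of_nonneg_right this (sq_nonneg (y n))]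
  refine le_trans ?_ hle
  -- If this sum diverges the bound is trivial; otherwise the differentiated series converges to
  -- some g, and v, g is a chain.
  by_cases htop : ∑' n, ENNReal.ofReal ((freq n * y n) ^ 2) = ⊤
  · simp [htop]
  have hsum : Summable fun n => (freq n * y n) ^ 2 :=
    (ENNReal.summable_toReal htop).congr fun n => ENNReal.toReal_ofReal (sq_nonneg _)
  obtain ⟨g, hg, hgn⟩ := exists_hasSum_cosMode hsum
  have hw : HasWeakDeriv 0 1 (v : ℝ → ℝ) (g : ℝ → ℝ) := by
    refine HasWeakDeriv.of_hasSum (fun n => ?_) (hasSum_sinMode v) hg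
    refine ((hasWeakDeriv_sinMode n).const_smul (y n)).congr
      (Lp.coeFn_smul _ _).symm ?_
    refine (Lp.coeFn_smul _ _).symm.trans (Filter.EventuallyEq.of_eq ?_)
    rw [smul_smul, mul_comm]
  have hfl : ⌊(1 : ℝ)⌋₊ = 1 := Nat.floor_one
  have := iInf₂_le (f := fun (D : ℕ → ℝ → ℝ) (_ : IsWeakDerivChain 0 1 1 D ∧ D 0 = v) =>
    ((∑ j ∈ Finset.range (⌊(1 : ℝ)⌋₊ + 1), eLpNorm (D j) 2 (volume.restrict (Ioo 0 1)) ^ 2) +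
      (if (1 : ℝ) - ⌊(1 : ℝ)⌋₊ = 0 then 0
        else gagliardoSq 0 1 (1 - ⌊(1 : ℝ)⌋₊) (D ⌊(1 : ℝ)⌋₊))) ^ (1 / 2 : ℝ))
    (fun j => if j = 0 then v else g) ⟨⟨fun j _ => by
        split_ifs
        exacts [Lp.memLp v, Lp.memLp g],
      fun j hj => by
        obtain rfl : j = 0 := by omega
        simpa using hw⟩, rfl⟩
  refine (pow_le_pow_left₀ zero_le this 2).trans (le_of_eq ?_)
  rw [rpow_half_sq, hfl]
  have e : ∀ w : L2, eLpNorm (w : ℝ → ℝ) 2 (volume.restrict (Ioo 0 1)) = ‖w‖ₑ := fun w =>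
    (Lp.enorm_def w).symm
  simp only [Finset.sum_range_succ, Finset.range_zero, Finset.sum_empty, zero_add, if_true,
    one_ne_zero, if_false, e, Nat.cast_one, sub_self, add_zero]
  rw [enorm_sq_eq_tsum, ← ofReal_norm g, ← ENNReal.ofReal_pow (norm_nonneg _), hgn,
    ENNReal.ofReal_tsum_of_nonneg (fun n => sq_nonneg _) hsum]

/-! ### From the heat equation to its coefficients. -/

/-- The coefficients of the constant function `1` in the Dirichlet basis. -/
def coefOne (n : ℕ) : ℝ := ∫ x in (0 : ℝ)..1, √2 * Real.sin (freq n * x)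

theorem inner_constL2_sinMode (c : ℝ) (n : ℕ) :
    inner ℝ (constL2 c) (sinMode n) = c * coefOne n := by
  rw [sinMode, inner_contL2, coefOne, intervalIntegral.integral_of_le zero_le_one,
    integral_Ioc_eq_integral_Ioo, ← integral_const_mul]
  refine integral_congr_ae ?_
  have : (constL2 c : ℝ → ℝ) =ᵐ[volume.restrict (Ioo (0 : ℝ) 1)] Function.const ℝ c :=
    Lp.coeFn_const _ _ _
  filter_upwards [this] with x hx
  rw [hx, Function.const_apply, mul_comm]

/-- Integrating the sine gives c_n √μ_n = √2 (1 - cos √μ_n), which lies between 0 and 2√2. -/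
theorem coefOne_sq_mul_eigenvalue_le (n : ℕ) : coefOne n ^ 2 * eigenvalue n ≤ 8 := by
  have h2 : √2 ^ 2 = (2 : ℝ) := Real.sq_sqrt (by norm_num)
  have e : coefOne n * freq n = √2 * (1 - Real.cos (freq n)) := by
    have := (freq_pos n).ne'
    rw [coefOne, intervalIntegral.integral_const_mul,
      intervalIntegral.integral_comp_mul_left (fun x => Real.sin x) this]
    simp
    field_simp
  rw [← freq_sq, ← mul_pow, e, mul_pow, h2]
  nlinarith [Real.neg_one_le_cos (freq n), Real.cos_le_one (freq n)]

theorem isTestFunction_sinMode (T : ℝ) (hT : 0 ≤ T) (n : ℕ) :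
    IsTestFunction T (fun _ => sinMode n) (fun _ => 0) (fun _ => freq n • cosMode n)
      (fun _ => -eigenvalue n • sinMode n) where
  continuousOn := continuousOn_const
  continuousOn_x := continuousOn_const
  memH10 _ _ := ⟨hasWeakDeriv_sinMode n, fun x => √2 * Real.sin (freq n * x),
    (continuous_sin_mode n).continuousOn, by simp, by
      simp only [mul_one, freq, Real.sin_nat_mul_pi, mul_zero],
    coeFn_contL2 (continuous_sin_mode n)⟩
  memLp_xx := memLp_const _
  weakDeriv_xx := ae_of_all _ fun _ => hasWeakDeriv_cosMode n
  memLp_t := memLp_const _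
  weakDeriv_t := hasWeakDeriv_of_hasDerivAt hT (fun _ => hasDerivAt_const _ _) continuous_const

namespace IsHeatSolution

variable {T : ℝ} {u : ℝ → ℝ} {y : ℝ → L2}

/-- The Dirichlet coefficients of the solution, continued by constants outside `[0, T]`. -/
def coef (hT : 0 ≤ T) (y : ℝ → L2) (n : ℕ) : ℝ → ℝ :=
  IccExtend hT fun t => inner ℝ (y t) (sinMode n)

theorem coef_of_mem (hT : 0 ≤ T) (y : ℝ → L2) (n : ℕ) {t : ℝ} (ht : t ∈ Icc 0 T) :
    coef hT y n t = inner ℝ (y t) (sinMode n) :=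
  IccExtend_of_mem _ _ ht

/-- Testing the weak formulation with the time-independent eigenfunction, for which φ_t = 0 and φ_xx
= -μ_n φ, yields the integrated scalar equation. -/
theorem isForward_coef (hT : 0 ≤ T) (hu : IntegrableOn u (Ioo 0 T))
    (h : IsHeatSolution T (fun t => constL2 (u t)) 0 y) (n : ℕ) :
    IsForward (eigenvalue n) T (coefOne n) u (coef hT y n) where
  int := (intervalIntegrable_iff_integrableOn_Ioo_of_le hT).2 hu
  cont := by
    have : ContinuousOn (fun t => inner ℝ (y t) (sinMode n)) (Icc 0 T) :=
      h.memYT.continuousOn.inner continuousOn_const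
    exact this.domRestrict.Icc_extend'
  eqn t ht := by
    have e := h.weak_form _ _ _ _ (isTestFunction_sinMode T hT n) t ht
    simp only [inner_zero_left, sub_zero, zero_add, inner_smul_right, inner_constL2_sinMode] at e
    rw [intervalIntegral.integral_const_mul, intervalIntegral.integral_mul_const] at e
    have e1 : ∫ s in 0..t, coef hT y n s = ∫ s in 0..t, inner ℝ (y s) (sinMode n) := by
      refine intervalIntegral.integral_congr fun s hs => ?_
      rw [uIcc_of_le ht.1] at hs
      exact coef_of_mem hT y n ⟨hs.1, hs.2.trans ht.2⟩
    rw [coef_of_mem hT y n ht, e1]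
    linarith

end IsHeatSolution

theorem lintegral_enorm_sq_eq_ofReal {T : ℝ} (hT : 0 ≤ T) {f : ℝ → ℝ}
    (hf : ContinuousOn f (Icc 0 T)) :
    ∫⁻ t in Ioo 0 T, ‖f t‖ₑ ^ 2 = ENNReal.ofReal (∫ t in 0..T, f t ^ 2) := by
  have hi : IntegrableOn (fun t => f t ^ 2) (Ioo 0 T) :=
    ((hf.pow 2).integrableOn_Icc).mono_set Ioo_subset_Icc_self
  rw [intervalIntegral.integral_of_le hT, integral_Ioc_eq_integral_Ioo,
    ofReal_integral_eq_lintegral_ofReal hi (ae_of_all _ fun x => sq_nonneg _)]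
  simp only [enorm_sq_eq_ofReal]

theorem aemeasurable_enorm_sq {T : ℝ} {f : ℝ → ℝ} (hf : ContinuousOn f (Icc 0 T)) :
    AEMeasurable (fun t => ‖f t‖ₑ ^ 2) (volume.restrict (Ioo 0 T)) :=
  (((hf.mono Ioo_subset_Icc_self).aemeasurable measurableSet_Ioo).enorm).pow_const 2

/-- Parseval at each time and Tonelli turn the norm into a series of nonnegative terms, so uniform
bounds on partial sums suffice; this is why all multipliers are finite sums. -/
theorem normL2L2_sq_le {T : ℝ} (hT : 0 ≤ T) {z : ℝ → L2}
    (hz : ∀ n, ContinuousOn (fun t => inner ℝ (z t) (sinMode n)) (Icc 0 T)) {B : ℝ≥0∞}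
    (hB : ∀ N, ENNReal.ofReal (∑ n ∈ Finset.range N, ∫ t in 0..T, inner ℝ (z t) (sinMode n) ^ 2)
      ≤ B) : normL2L2 T z ^ 2 ≤ B := by
  rw [normL2L2, eLpNorm_two_sq]
  simp only [enorm_sq_eq_tsum]
  rw [lintegral_tsum fun n => aemeasurable_enorm_sq (hz n)]
  simp only [lintegral_enorm_sq_eq_ofReal hT (hz _)]
  refine ENNReal.tsum_le_of_sum_range_le fun N => ?_
  rw [← ENNReal.ofReal_sum_of_nonneg fun n _ =>
    intervalIntegral.integral_nonneg hT fun t _ => sq_nonneg _]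
  exact hB N

theorem normL2H1_sq_le {T : ℝ} (hT : 0 ≤ T) {z : ℝ → L2}
    (hz : ∀ n, ContinuousOn (fun t => inner ℝ (z t) (sinMode n)) (Icc 0 T)) {B : ℝ≥0∞}
    (hB : ∀ N, ENNReal.ofReal (∑ n ∈ Finset.range N,
      eigenvalue n * ∫ t in 0..T, inner ℝ (z t) (sinMode n) ^ 2) ≤ B) :
    normL2H1 T z ^ 2 ≤ 2 * B := by
  rw [normL2H1, rpow_half_sq]
  refine (lintegral_mono fun t => sobolevENorm_one_sq_le_tsum (z t)).trans ?_
  rw [lintegral_tsum fun n => (aemeasurable_enorm_sq (hz n)).const_mul _]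
  simp only [lintegral_const_mul' _ _ ENNReal.ofReal_ne_top, lintegral_enorm_sq_eq_ofReal hT (hz _)]
  refine ENNReal.tsum_le_of_sum_range_le fun N => ?_
  refine le_trans (le_of_eq ?_) (mul_le_mul_right (hB N) 2)
  have hμ : ∀ n, 0 ≤ eigenvalue n := fun n => zero_le_one.trans (one_le_eigenvalue n)
  rw [ENNReal.ofReal_sum_of_nonneg fun n _ => mul_nonneg (hμ n)
    (intervalIntegral.integral_nonneg hT fun t _ => sq_nonneg _), Finset.mul_sum]
  refine Finset.sum_congr rfl fun n _ => ?_
  rw [ENNReal.ofReal_mul zero_le_two, ENNReal.ofReal_mul (hμ n), ENNReal.ofReal_ofNat, mul_assoc]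

end HeatControl

end

/-! ### Conclusion. -/

theorem proposition5p1 (T : ℝ) (hT : 0 < T) :
    ∃ C : ℝ≥0, 0 < C ∧
      ∀ u : ℝ → ℝ, IntegrableOn u (Ioo 0 T) →
      ∀ y : ℝ → HeatControl.L2,
        HeatControl.IsHeatSolution T (fun t => HeatControl.constL2 (u t)) 0 y →
          HeatControl.normL2H1 T y ≤ C * HeatControl.dualENorm T (3 / 4) u ∧
          HeatControl.normL2L2 T (fun t => y t - HeatControl.constL2 (∫ s in 0..t, u s))
            ≤ C * HeatControl.dualENorm T (5 / 4) u ∧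
          HeatControl.normL2L2 T y ≤ C * HeatControl.dualENorm T 1 u := by
  open HeatControl in
  have hG1 : 0 < gagliardoConst (5 / 2) := gagliardoConst_pos (by norm_num) (by norm_num)
  have hG2 : 0 < gagliardoConst (3 / 2) := gagliardoConst_pos (by norm_num) (by norm_num)
  have hK1 : 0 < energyConst := by unfold energyConst; positivity
  have hK2 : 0 < correctorConst T := by unfold correctorConst; positivity
  -- K dominates the constants of the three squared estimates, so C = √K serves for all; the factor
  -- 2 on the first is the loss 1 + μ_n ≤ 2 μ_n in the H¹ norm.
  set K : ℝ := 2 * energyConst + correctorConst T + 32 with hK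
  have hK0 : 0 < K := by positivity
  have hCK : ((√K).toNNReal : ℝ≥0∞) ^ 2 = ENNReal.ofReal K := by
    change ENNReal.ofReal √K ^ 2 = _
    rw [← ENNReal.ofReal_pow (Real.sqrt_nonneg _), Real.sq_sqrt hK0.le]
  refine ⟨(√K).toNNReal, by simpa using hK0, fun u hu y hy => ?_⟩
  have hui : IntervalIntegrable u volume 0 T :=
    (intervalIntegrable_iff_integrableOn_Ioo_of_le hT.le).2 hu
  have H := hy.isForward_coef hT.le hu
  have key : ∀ {x d : ℝ≥0∞} {k : ℝ}, k ≤ K → x ^ 2 ≤ ENNReal.ofReal k * d ^ 2 →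
      x ≤ (√K).toNNReal * d := by
    intro x d k hk hx
    rw [← ENNReal.pow_le_pow_left_iff two_ne_zero, mul_pow, hCK]
    exact hx.trans (by gcongr)
  have hyc : ∀ n, ContinuousOn (fun t => inner ℝ (y t) (sinMode n)) (Icc 0 T) := fun n =>
    hy.memYT.continuousOn.inner continuousOn_const
  have hcoef : ∀ n, ∫ t in 0..T, IsHeatSolution.coef hT.le y n t ^ 2
      = ∫ t in 0..T, inner ℝ (y t) (sinMode n) ^ 2 := fun n =>
    intervalIntegral.integral_congr fun t ht => by
      rw [uIcc_of_le hT.le] at ht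
      simp only [IsHeatSolution.coef_of_mem hT.le y n ht]
  refine ⟨?_, ?_, ?_⟩
  · refine key (k := 2 * energyConst) (by linarith) ?_
    rw [ENNReal.ofReal_mul zero_le_two, ENNReal.ofReal_ofNat, mul_assoc]
    refine normL2H1_sq_le hT.le hyc fun N => ?_
    simp only [← hcoef]
    exact sum_eigenvalue_mul_integral_sq_le_dualENorm hT coefOne_sq_mul_eigenvalue_le hui H N
  · refine key (k := correctorConst T) (by linarith) ?_
    have hz : ∀ n t, inner ℝ (y t - constL2 (∫ s in 0..t, u s)) (sinMode n)
        = inner ℝ (y t) (sinMode n) - coefOne n * ∫ s in 0..t, u s := fun n t => by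
      rw [inner_sub_left, inner_constL2_sinMode, mul_comm]
    refine normL2L2_sq_le hT.le (fun n => ?_) fun N => ?_
    · simp only [hz]
      refine (hyc n).sub (continuousOn_const.mul ?_)
      have := intervalIntegral.continuousOn_primitive_interval' hui left_mem_uIcc
      rwa [uIcc_of_le hT.le] at this
    · simp only [hz]
      refine le_trans (le_of_eq ?_)
        (sum_integral_sq_sub_le_dualENorm hT coefOne_sq_mul_eigenvalue_le hui H N)
      congr 1
      refine Finset.sum_congr rfl fun n _ => intervalIntegral.integral_congr fun t ht => ?_
      rw [uIcc_of_le hT.le] at ht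
      simp only [IsHeatSolution.coef_of_mem hT.le y n ht]
  · refine key (k := 32) (by linarith) (normL2L2_sq_le hT.le hyc fun N => ?_)
    simp only [← hcoef]
    exact sum_integral_sq_le_dualENorm_one hT coefOne_sq_mul_eigenvalue_le hui H N
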